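/- **Uniform Weinberg theorem.** Consider the rank-six $U(1)$ tensor field theory with quartic melonic interactions, mass $m>0$ and gauge-invariant propagator $$C(\vec p)=\frac{\delta_{\sum_{c}p_c,\,0}}{|\vec p|^2+m^2},\qquad \vec p=(p_1,\dots,p_6)\in\mathbb Z^6 .$$ A vertex of a Feynman graph $\mathcal G$ is a bubble with a special color $c\in\{1,\dots,6\}$; for $c=1$ it is $\sum\bar\phi(p_1,p_2,\dots,p_6)\,\phi(p_1',p_2,\dots,p_6)\,\bar\phi(p_1',p_2',\dots,p_6')\,\phi(p_1,p_2',\dots,p_6')$. An internal line joins a field $\phi$ to a field $\bar\phi$, and the fields not joined to another are the external half-lines. Faces of color $c$ are the connected components formed by the strands of color $c$ of lines and vertices; they are internal if closed, and external if they end on external half-lines. The amplitude of $\mathcal G$ at fixed integer momenta of the external faces is $$\mathcal A(\mathcal G)=\sum_{(p_f)\in\mathbb Z^{\{\text{internal faces } f\}}}\ \prod_{\ell\ \text{internal line}} C(\vec p^{\,\ell}),$$ where $p^{\ell}_c$ is the momentum of the face of color $c$ through $\ell$. A subgraph $\mathcal H\subset\mathcal G$ is a nonempty set of internal lines with the vertices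 attached to them; its divergence degree is $\omega(\mathcal H)=-2L(\mathcal H)+F(\mathcal H)-R(\mathcal H)$, where $L(\mathcal H)$ is its number of lines, $F(\mathcal H)$ its number of internal faces (closed faces running only through lines of $\mathcal H$), and $R(\mathcal H)$ the rank of the incidence matrix between its lines and its internal faces. Then, for every $m>0$, there is a constant $K>0$, depending only on $m$, such that for every connected graph $\mathcal G$ with $n(\mathcal G)$ vertices that is completely convergent, i.e. $\omega(\mathcal H)<0$ for all connected subgraphs $\mathcal H\subset\mathcal G$ ($\mathcal G$ itself included), and for all external momenta, the sum defining $\mathcal A(\mathcal G)$ converges absolutely and $$|\mathcal A(\mathcal G)|\le K^{n(\mathcal G)} .$$ -/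

import Mathlib

/-- A Feynman graph of the rank-six quartic melonic tensor model, with set of vertices `V` (quartic
bubbles) and set of internal lines `L`. A vertex `v` carries a special color and four half-lines:
the two fields `φ` numbered `(v, false)`, `(v, true)` and the two conjugate fields `φ̄` numbered
in the same way. A line (Wick contraction) joins a field `φ` to a field `φ̄`, and each field belongs
to at most one line; the fields that belong to no line are the external half-lines. -/
structure FeynmanGraph (V : Type*) (L : Type*) where
  /-- the special color of a vertex -/
  color : V → Fin 6
  /-- the field `φ` at one end of a line -/
  src : L → V × Bool
  /-- the field `φ̄` at the other end of a line -/
  tgt : L → V × Bool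
  src_injective : Function.Injective src
  tgt_injective : Function.Injective tgt

namespace FeynmanGraph

variable {V L : Type*} (G : FeynmanGraph V L)

/-- The strand of color `c` inside a bubble starting at the field `φ̄` number `h` ends at the field
`φ` number `G.strand c h`. For
`∑ φ̄(p₁, p₂, …, p₆) φ(p₁', p₂, …, p₆) φ̄(p₁', p₂', …, p₆') φ(p₁, p₂', …, p₆')` (special color `1`)
the conjugate field and the field with the same number are joined by the five non-special colors,
and the special color joins fields of different numbers. -/
def strand (c : Fin 6) (h : V × Bool) : V × Bool :=
  (h.1, if c = G.color h.1 then !h.2 else h.2)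

/-- Strand `c` of the line `ℓ` is followed, across a bubble, by strand `c` of the line `ℓ'`. -/
def FaceStep (x y : L × Fin 6) : Prop :=
  x.2 = y.2 ∧ G.strand x.2 (G.tgt x.1) = G.src y.1

/-- Faces of color `c` are the connected components made of strands of color `c`, of lines and of
bubbles. A face is given here as the class of the strands `(ℓ, c)` of lines it runs through. -/
def Face : Type _ := Quot G.FaceStep

/-- The face through strand `c` of the line `ℓ`. -/
def face (ℓ : L) (c : Fin 6) : G.Face := Quot.mk _ (ℓ, c)

instance [Finite L] : Finite G.Face := inferInstanceAs (Finite (Quot G.FaceStep))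

noncomputable instance [Finite L] : Fintype G.Face := Fintype.ofFinite _

/-- A face is internal (closed) if it never ends on an external half-line: each of its strands
is continued, at both ends, by a strand of an internal line. The other faces are external (open). -/
def IsInternal (f : G.Face) : Prop :=
  ∀ ℓ c, G.face ℓ c = f →
    (∃ y, G.FaceStep (ℓ, c) y) ∧ (∃ y, G.FaceStep y (ℓ, c))

/-- The graph on the vertices whose edges are the lines in `H`. -/
def lineGraph (H : Set L) : SimpleGraph V :=
  SimpleGraph.fromRel fun v w => ∃ ℓ ∈ H, (G.src ℓ).1 = v ∧ (G.tgt ℓ).1 = w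

/-- A Feynman graph is connected if its vertices are connected by its lines. -/
def IsConnected : Prop := (G.lineGraph Set.univ).Connected

/-- A subgraph is a set `H` of lines together with the vertices attached to them. It is connected
if it is nonempty and its vertices are connected by its lines. -/
def IsConnectedSubgraph (H : Finset L) : Prop :=
  H.Nonempty ∧ ∀ ℓ ∈ H, ∀ ℓ' ∈ H, (G.lineGraph H).Reachable (G.src ℓ).1 (G.src ℓ').1

open Classical in
/-- The internal faces of a subgraph: the closed faces that run only through lines of `H`. -/
noncomputable def internalFaces [Finite L] (H : Finset L) : Finset G.Face :=
  {f | G.IsInternal f ∧ ∀ ℓ c, G.face ℓ c = f → ℓ ∈ H}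

open Classical in
/-- The incidence matrix `ε` of the lines and internal faces of the subgraph `H`. As every line is
oriented from `φ` to `φ̄`, lines and faces always have coherent orientations, so no sign occurs;
a face (of color `c`) runs at most once through a given line. -/
noncomputable def incidence [Finite L] (H : Finset L) :
    Matrix {ℓ // ℓ ∈ H} {f // f ∈ G.internalFaces H} ℚ :=
  fun ℓ f => if ∃ c, G.face ℓ.1 c = f.1 then 1 else 0

/-- The divergence degree `ω(H) = -2 L(H) + F(H) - R(H)`. -/
noncomputable def divergenceDegree [Finite L] (H : Finset L) : ℤ :=
  -2 * (H.card : ℤ) + ((G.internalFaces H).card : ℤ) - ((G.incidence H).rank : ℤ)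

/-- A graph is completely convergent if all its connected subgraphs (itself included) have
negative divergence degree. -/
def IsCompletelyConvergent [Finite L] : Prop :=
  ∀ H : Finset L, G.IsConnectedSubgraph H → G.divergenceDegree H < 0

/-- The propagator `C(p) = δ(∑ p_c) / (|p|² + m²)` in momentum space. -/
noncomputable def propagator (m : ℝ) (p : Fin 6 → ℤ) : ℝ :=
  if ∑ c, p c = 0 then 1 / (∑ c, (p c : ℝ) ^ 2 + m ^ 2) else 0

open Classical in
/-- The momenta of all faces, given those of the external and of the internal faces. -/
noncomputable def faceMomentum (pext : {f // ¬ G.IsInternal f} → ℤ)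
    (q : {f // G.IsInternal f} → ℤ) (f : G.Face) : ℤ :=
  if h : G.IsInternal f then q ⟨f, h⟩ else pext ⟨f, h⟩

/-- The product of the propagators of all internal lines at given momenta of the faces. -/
noncomputable def integrand [Fintype L] (m : ℝ) (pext : {f // ¬ G.IsInternal f} → ℤ)
    (q : {f // G.IsInternal f} → ℤ) : ℝ :=
  ∏ ℓ : L, propagator m fun c => G.faceMomentum pext q (G.face ℓ c)

/-- The (amputated) amplitude at fixed external momenta: the sum over the momenta of all internal
faces of the product of the propagators of all internal lines. -/
noncomputable def amplitude [Fintype L] (m : ℝ) (pext : {f // ¬ G.IsInternal f} → ℤ) : ℝ :=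
  ∑' q : {f // G.IsInternal f} → ℤ, G.integrand m pext q

end FeynmanGraph

/-! Join a line to the next one when the `φ̄` end of the first and the `φ` end of the second carry
the same number at a bubble (a corner). Five colors pass straight through a corner and the gauge
constraint fixes the sixth, so all lines of a node, that is of a maximal sequence of lines joined at
corners, carry the same momentum `p`, in a lattice of rank five. The momentum of an open node is
fixed by the external momenta. A closed node with `k` lines contributes `C(p)^k`.

Complete convergence is used through lower bounds on `ω`, obtained by exhibiting kernel vectors of
the incidence matrix (`five_mul_card_le_divergenceDegree`). It excludes `k = 1`, forces the two
corners to have different special colors if `k = 2`, and forbids closed rings of two-line nodes.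

For `k ≥ 3` the sum of `C^3` converges (`tsum_propagator_cube_le`) and the nodes are summed
independently. For `k = 2` the sum of `C^2` diverges, but the special-color momenta `x`, `y` at the
two corners are shared with the neighbours. Summing over the other three directions leaves a kernel
of order `1/√(x² + y² + m²)`, of Hilbert type, hence bounded on `ℓ²` by the Schur test
(`tsum_propagator_sq_schur`). The two-line nodes thus form open chains of bounded operators
(`chain_bound`), closed at their ends by delta functions of norm one (`tsum_twoNode_le`). Each node
costs a constant, and there are at most two lines per vertex. -/

open scoped ENNReal

/-! ### Cauchy–Schwarz inequality and Schur test in `[0, ∞]` -/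

theorem ENNReal.two_mul_mul_le_sq_add_sq (x y : ℝ≥0∞) : 2 * (x * y) ≤ x ^ 2 + y ^ 2 := by
  rcases eq_or_ne x ∞ with rfl | hx
  · simp
  rcases eq_or_ne y ∞ with rfl | hy
  · simp
  lift x to NNReal using hx
  lift y to NNReal using hy
  have h := two_mul_le_add_sq x y
  rw [mul_assoc] at h
  exact_mod_cast h

/-- The weighted Cauchy–Schwarz inequality for sums of extended nonnegative numbers. -/
theorem ENNReal.sq_tsum_mul_le {E : Type*} (w a b : E → ℝ≥0∞) :
    (∑' p, w p * (a p * b p)) ^ 2 ≤ (∑' p, w p * a p ^ 2) * ∑' p, w p * b p ^ 2 := by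
  have expand : ∀ u v : E → ℝ≥0∞, (∑' p, u p) * ∑' q, v q = ∑' p, ∑' q, u p * v q := fun u v => by
    simp_rw [ENNReal.tsum_mul_left, ENNReal.tsum_mul_right]
  -- The square is expanded over pairs `(p, q)`, and the arithmetic-geometric inequality is applied
  -- to `a p * b q` and `a q * b p`.
  have key : 2 * (∑' p, w p * (a p * b p)) ^ 2
      ≤ 2 * ((∑' p, w p * a p ^ 2) * ∑' p, w p * b p ^ 2) := by
    calc 2 * (∑' p, w p * (a p * b p)) ^ 2
        = ∑' p, ∑' q, w p * w q * (2 * ((a p * b q) * (a q * b p))) := by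
          rw [sq, expand, ← ENNReal.tsum_mul_left]
          refine tsum_congr fun p => ?_
          rw [← ENNReal.tsum_mul_left]
          exact tsum_congr fun q => by ring
      _ ≤ ∑' p, ∑' q, w p * w q * ((a p * b q) ^ 2 + (a q * b p) ^ 2) := by
          gcongr
          exact ENNReal.two_mul_mul_le_sq_add_sq _ _
      _ = (∑' p, ∑' q, (w p * a p ^ 2) * (w q * b q ^ 2))
            + ∑' p, ∑' q, (w p * b p ^ 2) * (w q * a q ^ 2) := by
          rw [← ENNReal.tsum_add]
          refine tsum_congr fun p => ?_
          rw [← ENNReal.tsum_add]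
          exact tsum_congr fun q => by ring
      _ = 2 * ((∑' p, w p * a p ^ 2) * ∑' p, w p * b p ^ 2) := by
          rw [← expand, ← expand, mul_comm (∑' p, w p * b p ^ 2), two_mul]
  exact (ENNReal.mul_le_mul_iff_right (by simp) (by simp)).1 key

theorem ENNReal.tsum_fiber {E X : Type*} [DecidableEq X] (a : E → X) (F : E → ℝ≥0∞) :
    ∑' p, F p = ∑' x, ∑' p, if a p = x then F p else 0 := by
  rw [ENNReal.tsum_comm]
  exact tsum_congr fun p => by simp

/-- Allows the ratio `g y / g x` and its inverse to be inserted in the two factors before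
Cauchy–Schwarz is applied. -/
theorem ENNReal.schur_cancel {X : Type*} {g : X → ℝ≥0∞} (hg : ∀ x, g x ≠ 0)
    (hg' : ∀ x, g x ≠ ∞) (x y : X) (u v : ℝ≥0∞) :
    (u * (g y * (g x)⁻¹)) * (v * (g x * (g y)⁻¹)) = u * v := by
  calc _ = u * v * ((g x)⁻¹ * g x) * ((g y)⁻¹ * g y) := by ring
    _ = u * v := by
      rw [ENNReal.inv_mul_cancel (hg x) (hg' x), ENNReal.inv_mul_cancel (hg y) (hg' y)]; simp

section Schur

variable {E X : Type*} [DecidableEq X] {w : E → ℝ≥0∞} {a b : E → X} {g : X → ℝ≥0∞} {K : ℝ≥0∞}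

/-- One half of the Schur test: on the fiber `a p = x` the bound `hab` produces `g x ^ 2`, which
cancels the inverse weight. -/
theorem ENNReal.schur_tsum_le (hg : ∀ x, g x ≠ 0) (hg' : ∀ x, g x ≠ ∞)
    (hab : ∀ x, ∑' p, (if a p = x then w p * g (b p) ^ 2 else 0) ≤ K * g x ^ 2) (f : X → ℝ≥0∞) :
    ∑' p, w p * (f (a p) * (g (b p) * (g (a p))⁻¹)) ^ 2 ≤ K * ∑' x, f x ^ 2 := by
  rw [ENNReal.tsum_fiber a, ← ENNReal.tsum_mul_left]
  refine ENNReal.tsum_le_tsum fun x => ?_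
  calc ∑' p, (if a p = x then w p * (f (a p) * (g (b p) * (g (a p))⁻¹)) ^ 2 else 0)
      = (f x ^ 2 * (g x)⁻¹ ^ 2) * ∑' p, (if a p = x then w p * g (b p) ^ 2 else 0) := by
        rw [← ENNReal.tsum_mul_left]
        refine tsum_congr fun p => ?_
        split_ifs with h
        · subst h; ring
        · simp
    _ ≤ (f x ^ 2 * (g x)⁻¹ ^ 2) * (K * g x ^ 2) := by gcongr; exact hab x
    _ = K * f x ^ 2 * ((g x)⁻¹ * g x) ^ 2 := by ring
    _ = K * f x ^ 2 := by rw [ENNReal.inv_mul_cancel (hg x) (hg' x)]; simp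

/-- The Schur test for a bilinear form. -/
theorem ENNReal.schur_bilinear (hg : ∀ x, g x ≠ 0) (hg' : ∀ x, g x ≠ ∞)
    (hab : ∀ x, ∑' p, (if a p = x then w p * g (b p) ^ 2 else 0) ≤ K * g x ^ 2)
    (hba : ∀ x, ∑' p, (if b p = x then w p * g (a p) ^ 2 else 0) ≤ K * g x ^ 2)
    (f f' : X → ℝ≥0∞) :
    (∑' p, w p * (f (a p) * f' (b p))) ^ 2 ≤ K ^ 2 * ((∑' x, f x ^ 2) * ∑' x, f' x ^ 2) := by
  calc (∑' p, w p * (f (a p) * f' (b p))) ^ 2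
      = (∑' p, w p * ((f (a p) * (g (b p) * (g (a p))⁻¹))
          * (f' (b p) * (g (a p) * (g (b p))⁻¹)))) ^ 2 := by
        simp_rw [ENNReal.schur_cancel hg hg']
    _ ≤ _ := ENNReal.sq_tsum_mul_le _ _ _
    _ ≤ (K * ∑' x, f x ^ 2) * (K * ∑' x, f' x ^ 2) :=
        mul_le_mul' (ENNReal.schur_tsum_le hg hg' hab f) (ENNReal.schur_tsum_le hg hg' hba f')
    _ = _ := by ring

/-- The Schur test for an operator. -/
theorem ENNReal.schur_operator (hg : ∀ x, g x ≠ 0) (hg' : ∀ x, g x ≠ ∞)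
    (hab : ∀ x, ∑' p, (if a p = x then w p * g (b p) ^ 2 else 0) ≤ K * g x ^ 2)
    (hba : ∀ x, ∑' p, (if b p = x then w p * g (a p) ^ 2 else 0) ≤ K * g x ^ 2)
    (f : X → ℝ≥0∞) :
    ∑' y, (∑' p, if b p = y then w p * f (a p) else 0) ^ 2 ≤ K ^ 2 * ∑' x, f x ^ 2 := by
  have step : ∀ y, (∑' p, if b p = y then w p * f (a p) else 0) ^ 2
      ≤ K * ∑' p, (if b p = y then w p * (f (a p) * (g (b p) * (g (a p))⁻¹)) ^ 2 else 0) := by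
    intro y
    calc (∑' p, if b p = y then w p * f (a p) else 0) ^ 2
        = (∑' p, (if b p = y then w p else 0) * ((f (a p) * (g (b p) * (g (a p))⁻¹))
          * (1 * (g (a p) * (g (b p))⁻¹)))) ^ 2 := by
          simp_rw [ENNReal.schur_cancel hg hg', ite_mul, zero_mul, mul_one]
      _ ≤ _ := ENNReal.sq_tsum_mul_le _ _ _
      _ ≤ (∑' p, (if b p = y then w p else 0) * (f (a p) * (g (b p) * (g (a p))⁻¹)) ^ 2) * K := by
          gcongr
          calc ∑' p, (if b p = y then w p else 0) * (1 * (g (a p) * (g (b p))⁻¹)) ^ 2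
              = (g y)⁻¹ ^ 2 * ∑' p, (if b p = y then w p * g (a p) ^ 2 else 0) := by
                rw [← ENNReal.tsum_mul_left]
                refine tsum_congr fun p => ?_
                split_ifs with h
                · subst h; ring
                · simp
            _ ≤ (g y)⁻¹ ^ 2 * (K * g y ^ 2) := by gcongr; exact hba y
            _ = K * ((g y)⁻¹ * g y) ^ 2 := by ring
            _ = K := by rw [ENNReal.inv_mul_cancel (hg y) (hg' y)]; simp
      _ = _ := by simp_rw [mul_comm _ K, ite_mul, zero_mul]
  calc ∑' y, (∑' p, if b p = y then w p * f (a p) else 0) ^ 2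
      ≤ ∑' y, K * ∑' p, (if b p = y then w p * (f (a p) * (g (b p) * (g (a p))⁻¹)) ^ 2 else 0) :=
        ENNReal.tsum_le_tsum step
    _ = K * ∑' p, w p * (f (a p) * (g (b p) * (g (a p))⁻¹)) ^ 2 := by
        rw [ENNReal.tsum_mul_left, ← ENNReal.tsum_fiber]
    _ ≤ K * (K * ∑' x, f x ^ 2) := by gcongr; exact ENNReal.schur_tsum_le hg hg' hab f
    _ = _ := by ring

end Schur

/-! ### One-dimensional lattice sums -/

section OneDimensional

theorem ENNReal.tsum_ofReal_le_of_telescoping {f g : ℕ → ℝ} (hf : ∀ n, 0 ≤ f n)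
    (hg : ∀ n, 0 ≤ g n) (h : ∀ n, f n ≤ g n - g (n + 1)) :
    ∑' n, ENNReal.ofReal (f n) ≤ ENNReal.ofReal (g 0) := by
  refine ENNReal.tsum_le_of_sum_range_le fun n => ?_
  rw [← ENNReal.ofReal_sum_of_nonneg fun i _ => hf i]
  refine ENNReal.ofReal_le_ofReal ?_
  calc ∑ i ∈ Finset.range n, f i ≤ ∑ i ∈ Finset.range n, (g i - g (i + 1)) :=
        Finset.sum_le_sum fun i _ => h i
    _ = g 0 - g n := Finset.sum_range_sub' g n
    _ ≤ g 0 := by linarith [hg n]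

theorem ENNReal.tsum_int_even_le {f : ℤ → ℝ≥0∞} (hf : ∀ n, f (-n) = f n) :
    ∑' n, f n ≤ f 0 + 2 * ∑' n : ℕ, f (n + 1) := by
  have h : ∑' n, f n = _ := (HasSum.of_nat_of_neg_add_one (f := f)
    ENNReal.summable.hasSum ENNReal.summable.hasSum).tsum_eq
  rw [h, tsum_eq_zero_add' (f := fun n : ℕ => f n) ENNReal.summable, two_mul, add_assoc]
  simp only [hf]
  simp

/-- Comparison with the telescoping sequence `2 / (A + n)`. The zero term `1 / A²` is at most `(1 /
m) * A⁻¹`, and the two half-lines give `4 * A⁻¹`. -/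
theorem tsum_int_inv_sq_le {m A : ℝ} (hm : 0 < m) (hA : m ≤ A) :
    ∑' a : ℤ, ENNReal.ofReal (1 / (A ^ 2 + (a : ℝ) ^ 2))
      ≤ ENNReal.ofReal ((1 / m + 4) * A⁻¹) := by
  have hA0 : 0 < A := hm.trans_le hA
  refine (ENNReal.tsum_int_even_le fun n => by simp).trans ?_
  have h : ∑' n : ℕ, ENNReal.ofReal (1 / (A ^ 2 + (((n : ℤ) + 1 : ℤ) : ℝ) ^ 2))
      ≤ ENNReal.ofReal (2 * (1 / (A + (0 : ℕ)))) := by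
    refine ENNReal.tsum_ofReal_le_of_telescoping (g := fun n => 2 * (1 / (A + (n : ℕ))))
      (fun n => by positivity) (fun n => by positivity) fun n => ?_
    have hn : (0 : ℝ) ≤ n := n.cast_nonneg
    push_cast
    have e : 2 * (1 / (A + n)) - 2 * (1 / (A + (n + 1)))
        = 2 / ((A + n) * (A + (n + 1))) := by field_simp; ring
    rw [e, div_le_div_iff₀ (by positivity) (by positivity)]
    nlinarith [sq_nonneg (A - (n + 1))]
  calc _ ≤ ENNReal.ofReal (1 / (A ^ 2 + ((0 : ℤ) : ℝ) ^ 2))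
        + 2 * ENNReal.ofReal (2 * (1 / (A + (0 : ℕ)))) := by gcongr
    _ = ENNReal.ofReal (1 / A ^ 2 + 2 * (2 * (1 / A))) := by
        rw [ENNReal.ofReal_add (by positivity) (by positivity),
          ENNReal.ofReal_mul (p := 2) (by norm_num)]
        simp
    _ ≤ _ := by
        refine ENNReal.ofReal_le_ofReal ?_
        have : 1 / A ^ 2 ≤ 1 / m * A⁻¹ := by
          rw [sq, ← one_div_mul_one_div, ← one_div A]
          gcongr
        have e : 2 * (2 * (1 / A)) = 4 * A⁻¹ := by ring
        linarith

/-- An algebraic substitute for the integral of `1/((A + y)√y)`: the function `√(A + y) - √y`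
decreases over a unit step by at least `A / (4 √(y+1) (A + y + 1))`. Its value `√A` at `y = 0` makes
the telescoped sum of order `1/√A`. -/
theorem one_div_add_mul_sqrt_le {A y : ℝ} (hA : 0 < A) (hy : 0 ≤ y) :
    1 / ((A + (y + 1)) * √(y + 1))
      ≤ 4 / A * (√(A + y) - √y) - 4 / A * (√(A + (y + 1)) - √(y + 1)) := by
  set a := √y with ha
  set b := √(y + 1) with hb
  set c := √(A + y) with hc
  set d := √(A + (y + 1)) with hd
  have ha2 : a ^ 2 = y := Real.sq_sqrt hy
  have hb2 : b ^ 2 = y + 1 := Real.sq_sqrt (by linarith)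
  have hc2 : c ^ 2 = A + y := Real.sq_sqrt (by linarith)
  have hd2 : d ^ 2 = A + (y + 1) := Real.sq_sqrt (by linarith)
  have ha0 : 0 ≤ a := Real.sqrt_nonneg _
  have hb0 : 0 < b := Real.sqrt_pos.2 (by linarith)
  have hc0 : 0 < c := Real.sqrt_pos.2 (by linarith)
  have hd0 : 0 < d := Real.sqrt_pos.2 (by linarith)
  have hab : a ≤ b := Real.sqrt_le_sqrt (by linarith)
  have hcd : c ≤ d := Real.sqrt_le_sqrt (by linarith)
  have hac : a ≤ c := Real.sqrt_le_sqrt (by linarith)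
  have hbd : b ≤ d := Real.sqrt_le_sqrt (by linarith)
  have e1 : b - a = 1 / (b + a) := by
    field_simp; nlinarith
  have e2 : d - c = 1 / (d + c) := by
    field_simp; nlinarith
  have e3 : d - b = A / (d + b) := by
    field_simp; nlinarith
  have e4 : A / (2 * d) ≤ d - b := by
    rw [e3]; exact div_le_div_of_nonneg_left hA.le (by positivity) (by linarith)
  have e5 : A / (4 * b * d ^ 2) ≤ (b - a) - (d - c) := by
    have : (b - a) - (d - c) = ((d + c) - (b + a)) / ((b + a) * (d + c)) := by
      rw [e1, e2]; field_simp
    rw [this, div_le_div_iff₀ (by positivity) (by positivity)]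
    have h1 : A / d ≤ (d + c) - (b + a) := by
      have e6 : c - a = A / (c + a) := by field_simp; nlinarith
      have e7 : A / (2 * d) ≤ c - a := by
        rw [e6]; exact div_le_div_of_nonneg_left hA.le (by positivity) (by linarith)
      have e8 : A / d = A / (2 * d) + A / (2 * d) := by field_simp; ring
      linarith
    have h2 : (b + a) * (d + c) ≤ (2 * b) * (2 * d) := by gcongr <;> linarith
    calc A * ((b + a) * (d + c)) ≤ A * ((2 * b) * (2 * d)) := by gcongr
      _ = A / d * (4 * b * d ^ 2) := by field_simp; ring
      _ ≤ _ := by gcongr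
  calc 1 / ((A + (y + 1)) * b) = 4 / A * (A / (4 * b * d ^ 2)) := by rw [hd2]; field_simp
    _ ≤ 4 / A * ((b - a) - (d - c)) := by gcongr
    _ = _ := by ring

/-- The Hilbert type inequality behind the Schur test. -/
theorem tsum_int_inv_mul_inv_sqrt_le {m A : ℝ} (hm : 0 < m) (hA : m ≤ A) :
    ∑' y : ℤ, ENNReal.ofReal (1 / √(A ^ 2 + (y : ℝ) ^ 2) * (1 / √(√((y : ℝ) ^ 2 + m ^ 2))))
      ≤ ENNReal.ofReal ((1 / m + 16) * (1 / √A)) := by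
  have hA0 : 0 < A := hm.trans_le hA
  refine (ENNReal.tsum_int_even_le fun n => by simp).trans ?_
  have h : ∑' n : ℕ, ENNReal.ofReal (1 / √(A ^ 2 + (((n : ℤ) + 1 : ℤ) : ℝ) ^ 2)
        * (1 / √(√((((n : ℤ) + 1 : ℤ) : ℝ) ^ 2 + m ^ 2))))
      ≤ ENNReal.ofReal (2 * (4 / A * (√(A + (0 : ℕ)) - √((0 : ℕ) : ℝ)))) := by
    refine ENNReal.tsum_ofReal_le_of_telescoping
      (g := fun n : ℕ => 2 * (4 / A * (√(A + n) - √(n : ℝ))))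
      (fun n => by positivity) (fun n => ?_) fun n => ?_
    · have : √(n : ℝ) ≤ √(A + n) := Real.sqrt_le_sqrt (by linarith)
      have := sub_nonneg.2 this
      positivity
    · have hn : (0 : ℝ) ≤ n := n.cast_nonneg
      push_cast
      have h1 : 1 / √(A ^ 2 + ((n : ℝ) + 1) ^ 2) ≤ 2 * (1 / (A + (n + 1))) := by
        rw [mul_one_div, div_le_div_iff₀ (by positivity) (by positivity), one_mul]
        rw [← Real.sqrt_sq (show 0 ≤ A + ((n : ℝ) + 1) by positivity),
          ← Real.sqrt_sq (show (0 : ℝ) ≤ 2 by norm_num), ← Real.sqrt_mul (by norm_num)]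
        refine Real.sqrt_le_sqrt ?_
        nlinarith [sq_nonneg (A - (n + 1)), sq_nonneg A, sq_nonneg ((n : ℝ) + 1)]
      have h2 : 1 / √(√(((n : ℝ) + 1) ^ 2 + m ^ 2)) ≤ 1 / √((n : ℝ) + 1) := by
        refine one_div_le_one_div_of_le (by positivity) (Real.sqrt_le_sqrt ?_)
        exact Real.le_sqrt_of_sq_le (by nlinarith)
      calc _ ≤ 2 * (1 / (A + (n + 1))) * (1 / √((n : ℝ) + 1)) := by gcongr
        _ = 2 * (1 / ((A + (n + 1)) * √((n : ℝ) + 1))) := by field_simp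
        _ ≤ _ := by
          have := one_div_add_mul_sqrt_le hA0 hn
          linarith
  calc _ ≤ ENNReal.ofReal (1 / √(A ^ 2 + ((0 : ℤ) : ℝ) ^ 2)
          * (1 / √(√(((0 : ℤ) : ℝ) ^ 2 + m ^ 2))))
        + 2 * ENNReal.ofReal (2 * (4 / A * (√(A + (0 : ℕ)) - √((0 : ℕ) : ℝ)))) := by gcongr
    -- The constant 16 collects 4 from the telescoping bound, 2 from `A + y ≤ 2√(A² + y²)` and 2
    -- from the two half-lines.
    _ = ENNReal.ofReal (1 / A * (1 / √m) + 16 * (√A / A)) := by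
        rw [ENNReal.ofReal_add (by positivity) (by positivity),
          show 16 * (√A / A) = 2 * (2 * (4 / A * √A)) by ring,
          ENNReal.ofReal_mul (p := 2) (by norm_num)]
        simp [Real.sqrt_sq hA0.le, Real.sqrt_sq hm.le]
    _ ≤ _ := by
        refine ENNReal.ofReal_le_ofReal ?_
        have h3 : √A / A = 1 / √A := by
          rw [div_eq_div_iff hA0.ne' (by positivity), Real.mul_self_sqrt hA0.le, one_mul]
        have h4 : 1 / A * (1 / √m) ≤ 1 / m * (1 / √A) := by
          rw [one_div_mul_one_div, one_div_mul_one_div]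
          refine one_div_le_one_div_of_le (by positivity) ?_
          nth_rewrite 1 [← Real.mul_self_sqrt hm.le]
          nth_rewrite 2 [← Real.mul_self_sqrt hA0.le]
          have := Real.sqrt_le_sqrt hA
          calc √m * √m * √A = √m * √A * √m := by ring
            _ ≤ √A * √A * √m := by gcongr
        rw [h3]; linarith

end OneDimensional

/-! ### Lattice sums in several dimensions -/

theorem inv_sqrt_pow_succ_le {A a : ℝ} (hA : 0 < A) (k : ℕ) :
    (√(A ^ 2 + a ^ 2))⁻¹ ^ (k + 2) ≤ A⁻¹ ^ k * (1 / (A ^ 2 + a ^ 2)) := by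
  have h1 : A ≤ √(A ^ 2 + a ^ 2) := Real.le_sqrt_of_sq_le (by nlinarith)
  have h2 : (√(A ^ 2 + a ^ 2))⁻¹ ^ 2 = 1 / (A ^ 2 + a ^ 2) := by
    rw [inv_pow, Real.sq_sqrt (by positivity), one_div]
  rw [pow_add, h2]
  gcongr

/-- Induction on the dimension: splitting off a coordinate `a` replaces `A` by `√(A² + a²)` and `k`
by `k + 1`. The extra power provides the factor `1 / (A² + a²)` that is summed over `a`. -/
theorem tsum_fin_inv_sqrt_pow_le {m : ℝ} (hm : 0 < m) (n k : ℕ) (A : ℝ) (hA : m ≤ A) :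
    ∑' u : Fin n → ℤ, ENNReal.ofReal ((√(A ^ 2 + ∑ j, (u j : ℝ) ^ 2))⁻¹ ^ (n + k + 1))
      ≤ ENNReal.ofReal ((1 / m + 4) ^ n * A⁻¹ ^ (k + 1)) := by
  induction n generalizing k A with
  | zero =>
    have hA0 : 0 < A := hm.trans_le hA
    simp [Real.sqrt_sq hA0.le]
  | succ n ih =>
    have hA0 : 0 < A := hm.trans_le hA
    rw [← (Fin.consEquiv fun _ => ℤ).tsum_eq, ENNReal.tsum_prod']
    have h1 : ∀ a : ℤ, ∑' u : Fin n → ℤ, ENNReal.ofReal ((√(A ^ 2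
        + ∑ j, (((Fin.consEquiv fun _ => ℤ) (a, u) : Fin (n + 1) → ℤ) j : ℝ) ^ 2))⁻¹
          ^ (n + 1 + k + 1))
        ≤ ENNReal.ofReal ((1 / m + 4) ^ n * A⁻¹ ^ k) *
          ENNReal.ofReal (1 / (A ^ 2 + (a : ℝ) ^ 2)) := by
      intro a
      have h2 : A ≤ √(A ^ 2 + (a : ℝ) ^ 2) := Real.le_sqrt_of_sq_le (by nlinarith [sq_nonneg (a : ℝ)])
      have h3 := ih (k + 1) (√(A ^ 2 + (a : ℝ) ^ 2)) (hA.trans h2)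
      rw [Real.sq_sqrt (by positivity)] at h3
      rw [← ENNReal.ofReal_mul (by positivity)]
      refine le_trans (le_of_eq ?_) (h3.trans (ENNReal.ofReal_le_ofReal ?_))
      · refine tsum_congr fun u => ?_
        simp only [Fin.consEquiv_apply, Fin.sum_univ_succ, Fin.cons_zero, Fin.cons_succ]
        rw [← add_assoc (A ^ 2), show n + 1 + k + 1 = n + (k + 1) + 1 by ring]
      · rw [mul_assoc]
        gcongr
        exact inv_sqrt_pow_succ_le hA0 k
    refine (ENNReal.tsum_le_tsum h1).trans ?_
    rw [ENNReal.tsum_mul_left]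
    refine (mul_le_mul_right (tsum_int_inv_sq_le hm hA) _).trans ?_
    rw [← ENNReal.ofReal_mul (by positivity)]
    exact ENNReal.ofReal_le_ofReal (le_of_eq (by ring))

/-! ### Sums of powers of the propagator -/

namespace FeynmanGraph

theorem propagator_nonneg (m : ℝ) (p : Fin 6 → ℤ) : 0 ≤ propagator m p := by
  unfold propagator; split_ifs <;> positivity

theorem sum_eq_zero_of_propagator_ne_zero {m : ℝ} {p : Fin 6 → ℤ} (h : propagator m p ≠ 0) :
    ∑ c, p c = 0 := by
  by_contra h'
  exact h (if_neg h')

theorem propagator_le {m : ℝ} (hm : 0 < m) (p : Fin 6 → ℤ) : propagator m p ≤ 1 / m ^ 2 := by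
  unfold propagator
  split_ifs
  · have : 0 ≤ ∑ c, (p c : ℝ) ^ 2 := Finset.sum_nonneg fun _ _ => sq_nonneg _
    exact one_div_le_one_div_of_le (by positivity) (by linarith)
  · positivity

theorem propagator_comp_perm (m : ℝ) (p : Fin 6 → ℤ) (σ : Equiv.Perm (Fin 6)) :
    propagator m (p ∘ σ) = propagator m p := by
  simp only [propagator, Function.comp_apply, Equiv.sum_comp σ p,
    Equiv.sum_comp σ fun c => (p c : ℝ) ^ 2]

/-- The propagator in the form used for iterated sums. -/
theorem propagator_eq_inv_sqrt {m : ℝ} {p : Fin 6 → ℤ} (hp : ∑ c, p c = 0) :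
    propagator m p = (√(∑ c, (p c : ℝ) ^ 2 + m ^ 2))⁻¹ ^ 2 := by
  rw [propagator, if_pos hp, inv_pow, Real.sq_sqrt (by positivity), one_div]

/-- The gauge constraint recovers `p 0` from the other five coordinates, and dropping `p 0 ^ 2` only
increases the summand. This leaves the power 6 in dimension 5. -/
theorem tsum_propagator_cube_le {m : ℝ} (hm : 0 < m) :
    ∑' p : Fin 6 → ℤ, ENNReal.ofReal (propagator m p) ^ 3
      ≤ ENNReal.ofReal ((1 / m + 4) ^ 5 * m⁻¹) := by
  have hinj : Function.Injective
      fun p : {p : Fin 6 → ℤ // ∑ c, p c = 0} => fun j : Fin 5 => p.1 j.succ := by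
    rintro ⟨p, hp⟩ ⟨q, hq⟩ h
    have h' : ∀ j : Fin 5, p j.succ = q j.succ := fun j => congrFun h j
    rw [Fin.sum_univ_succ] at hp hq
    ext c
    refine Fin.cases ?_ h' c
    simp only [h'] at hp
    simp only
    linarith
  have hsupp : Function.support (fun p : Fin 6 → ℤ => ENNReal.ofReal (propagator m p) ^ 3)
      ⊆ {p | ∑ c, p c = 0} := by
    intro p hp
    refine sum_eq_zero_of_propagator_ne_zero (m := m) fun h => hp ?_
    simp [h]
  rw [← tsum_subtype_eq_of_support_subset hsupp]
  refine le_trans ?_ ((ENNReal.tsum_comp_le_tsum_of_injective hinj _).trans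
    ((tsum_fin_inv_sqrt_pow_le hm 5 0 m le_rfl).trans_eq (by simp)))
  refine ENNReal.tsum_le_tsum ?_
  rintro ⟨p, hp⟩
  simp only
  rw [← ENNReal.ofReal_pow (propagator_nonneg m p), propagator_eq_inv_sqrt hp, ← pow_mul]
  refine ENNReal.ofReal_le_ofReal ?_
  rw [Fin.sum_univ_succ]
  gcongr (√?_)⁻¹ ^ _
  have : 0 ≤ (p 0 : ℝ) ^ 2 := sq_nonneg _
  linarith

/-- The weight of the Schur test. -/
noncomputable def schurWeight (m : ℝ) (x : ℤ) : ℝ≥0∞ :=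
  ENNReal.ofReal (√(1 / √(√((x : ℝ) ^ 2 + m ^ 2))))

theorem schurWeight_sq {m : ℝ} (x : ℤ) :
    schurWeight m x ^ 2 = ENNReal.ofReal (1 / √(√((x : ℝ) ^ 2 + m ^ 2))) := by
  rw [schurWeight, ← ENNReal.ofReal_pow (by positivity), Real.sq_sqrt (by positivity)]

theorem schurWeight_ne_zero {m : ℝ} (hm : 0 < m) (x : ℤ) : schurWeight m x ≠ 0 := by
  rw [schurWeight, Ne, ENNReal.ofReal_eq_zero, not_le]
  positivity

/-- The constant of the Schur test. -/
noncomputable def schurConst (m : ℝ) : ℝ := (1 / m + 4) ^ 3 * (1 / m + 16)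

/-- With `p 0 = x` and `p 1 = y` fixed and `p 2` given by the constraint, three directions are free,
and `C²` summed over them is of order `1/√(x² + y² + m²)`. This kernel maps the squared weight, of
order `|y|^(-1/2)`, to a multiple of itself. -/
theorem tsum_propagator_sq_schur_zero_one {m : ℝ} (hm : 0 < m) (x : ℤ) :
    ∑' p : Fin 6 → ℤ, (if p 0 = x then
      ENNReal.ofReal (propagator m p) ^ 2 * schurWeight m (p 1) ^ 2 else 0)
      ≤ ENNReal.ofReal (schurConst m) * schurWeight m x ^ 2 := by
  have hinj : Function.Injective
      fun p : {p : Fin 6 → ℤ // ∑ c, p c = 0 ∧ p 0 = x} =>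
        ((p.1 1, fun j : Fin 3 => p.1 j.succ.succ.succ) : ℤ × (Fin 3 → ℤ)) := by
    rintro ⟨p, hp, hpx⟩ ⟨q, hq, hqx⟩ h
    simp only [Prod.mk.injEq] at h
    have h3 : p 3 = q 3 := congrFun h.2 0
    have h4 : p 4 = q 4 := congrFun h.2 1
    have h5 : p 5 = q 5 := congrFun h.2 2
    rw [Fin.sum_univ_six] at hp hq
    ext c
    fin_cases c <;> simp <;> linarith [h.1]
  have hsupp : Function.support (fun p : Fin 6 → ℤ => if p 0 = x then
      ENNReal.ofReal (propagator m p) ^ 2 * schurWeight m (p 1) ^ 2 else 0)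
      ⊆ {p | ∑ c, p c = 0 ∧ p 0 = x} := by
    intro p hp
    simp only [Function.mem_support, ne_eq, ite_eq_right_iff, Classical.not_imp] at hp
    refine ⟨sum_eq_zero_of_propagator_ne_zero (m := m) fun h => hp.2 ?_, hp.1⟩
    simp [h]
  rw [← tsum_subtype_eq_of_support_subset hsupp]
  set A := √((x : ℝ) ^ 2 + m ^ 2) with hA
  have hmA : m ≤ A := Real.le_sqrt_of_sq_le (by nlinarith [sq_nonneg (x : ℝ)])
  have hA2 : A ^ 2 = (x : ℝ) ^ 2 + m ^ 2 := Real.sq_sqrt (by positivity)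
  have hA0 : 0 < A := hm.trans_le hmA
  calc _ ≤ ∑' z : ℤ × (Fin 3 → ℤ), ENNReal.ofReal
          ((√(√(A ^ 2 + (z.1 : ℝ) ^ 2) ^ 2 + ∑ j, (z.2 j : ℝ) ^ 2))⁻¹ ^ (3 + 0 + 1))
            * schurWeight m z.1 ^ 2 := by
        refine le_trans ?_ (ENNReal.tsum_comp_le_tsum_of_injective hinj _)
        refine ENNReal.tsum_le_tsum ?_
        rintro ⟨p, hp, rfl⟩
        simp only [if_true]
        gcongr
        rw [← ENNReal.ofReal_pow (propagator_nonneg m p), propagator_eq_inv_sqrt hp, ← pow_mul]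
        refine ENNReal.ofReal_le_ofReal ?_
        gcongr (√?_)⁻¹ ^ _
        rw [Real.sq_sqrt (by positivity), hA2, Fin.sum_univ_six, Fin.sum_univ_three]
        have : 0 ≤ (p 2 : ℝ) ^ 2 := sq_nonneg _
        simp only [show (Fin.succ (Fin.succ (Fin.succ (0 : Fin 3))) : Fin 6) = 3 from rfl,
          show (Fin.succ (Fin.succ (Fin.succ (1 : Fin 3))) : Fin 6) = 4 from rfl,
          show (Fin.succ (Fin.succ (Fin.succ (2 : Fin 3))) : Fin 6) = 5 from rfl]
        linarith
    _ ≤ ∑' y : ℤ, ENNReal.ofReal ((1 / m + 4) ^ 3) * ENNReal.ofReal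
          (1 / √(A ^ 2 + (y : ℝ) ^ 2) * (1 / √(√((y : ℝ) ^ 2 + m ^ 2)))) := by
        rw [ENNReal.tsum_prod']
        refine ENNReal.tsum_le_tsum fun y => ?_
        simp only
        rw [ENNReal.tsum_mul_right]
        have hy : m ≤ √(A ^ 2 + (y : ℝ) ^ 2) :=
          hmA.trans (Real.le_sqrt_of_sq_le (by nlinarith [sq_nonneg (y : ℝ)]))
        refine (mul_le_mul_left (tsum_fin_inv_sqrt_pow_le hm 3 0 _ hy) _).trans_eq ?_
        rw [schurWeight_sq, ENNReal.ofReal_mul (by positivity), zero_add, pow_one, mul_assoc,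
          ENNReal.ofReal_mul (by positivity), one_div (√(A ^ 2 + (y : ℝ) ^ 2))]
    _ ≤ ENNReal.ofReal ((1 / m + 4) ^ 3) * ENNReal.ofReal ((1 / m + 16) * (1 / √A)) := by
        rw [ENNReal.tsum_mul_left]
        gcongr
        exact tsum_int_inv_mul_inv_sqrt_le hm hmA
    _ = _ := by
        rw [schurWeight_sq, ← ENNReal.ofReal_mul (by positivity),
          ← ENNReal.ofReal_mul (by unfold schurConst; positivity), schurConst, mul_assoc]

theorem tsum_propagator_sq_schur {m : ℝ} (hm : 0 < m) {c c' : Fin 6} (hc : c ≠ c') (x : ℤ) :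
    ∑' p : Fin 6 → ℤ, (if p c = x then
      ENNReal.ofReal (propagator m p) ^ 2 * schurWeight m (p c') ^ 2 else 0)
      ≤ ENNReal.ofReal (schurConst m) * schurWeight m x ^ 2 := by
  obtain ⟨σ, h0, h1⟩ : ∃ σ : Equiv.Perm (Fin 6), σ c = 0 ∧ σ c' = 1 := by
    refine ⟨(Equiv.swap c 0).trans (Equiv.swap (Equiv.swap c 0 c') 1), ?_, by simp⟩
    have h : Equiv.swap c 0 c' ≠ 0 := fun h =>
      hc ((Equiv.swap c 0).injective (by rw [h, Equiv.swap_apply_left]))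
    simp [Equiv.swap_apply_of_ne_of_ne h.symm (show (0 : Fin 6) ≠ 1 by decide)]
  refine le_trans (le_of_eq ?_) (tsum_propagator_sq_schur_zero_one hm x)
  rw [← (Equiv.arrowCongr σ.symm (Equiv.refl ℤ)).tsum_eq]
  refine tsum_congr fun p => ?_
  have e : (Equiv.arrowCongr σ.symm (Equiv.refl ℤ)) p = p ∘ σ := rfl
  rw [e, propagator_comp_perm]
  simp [h0, h1]

end FeynmanGraph

/-! ### Contraction of open chains of operators -/

section Chain

variable {X : Type*} {E : Type*}

open Classical in
/-- The factor attached to the corner `κ`: a boundary weight if no other corner is glued to it, and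
the constraint that the values on glued corners agree otherwise. -/
noncomputable def chainFactor {I : Type*} (flip : X → X) (e : I × Bool → X) (val : I × Bool → E → ℤ)
    (f : I × Bool → ℤ → ℝ≥0∞) (P : I → E) (κ : I × Bool) : ℝ≥0∞ :=
  if ∃ κ', e κ' = flip (e κ) then
    (if ∀ κ', e κ' = flip (e κ) → val κ (P κ.1) = val κ' (P κ'.1) then 1 else 0)
  else f κ (val κ (P κ.1))

open Classical in
/-- The squared norm of the boundary weight at the corner `κ`. -/
noncomputable def chainNorm {I : Type*} (flip : X → X) (e : I × Bool → X)
    (f : I × Bool → ℤ → ℝ≥0∞) (κ : I × Bool) : ℝ≥0∞ :=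
  if ∃ κ', e κ' = flip (e κ) then 1 else ∑' x, f κ x ^ 2

open Classical in
theorem chainFactor_le_one {I : Type*} {flip : X → X} {e : I × Bool → X} {val : I × Bool → E → ℤ}
    {f : I × Bool → ℤ → ℝ≥0∞} {P : I → E} {κ : I × Bool} (h : ∃ κ', e κ' = flip (e κ)) :
    chainFactor flip e val f P κ ≤ 1 := by
  unfold chainFactor
  rw [if_pos h]
  split_ifs <;> simp

theorem prod_prod_bool {M : Type*} [CommMonoid M] {I : Type*} [Fintype I] [DecidableEq I]
    (F : I × Bool → M) (i : I) (b : Bool) :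
    ∏ κ, F κ = F (i, b) * F (i, !b) * ∏ κ : {j // j ≠ i} × Bool, F (κ.1, κ.2) := by
  rw [Fintype.prod_prod_type, Fintype.prod_eq_mul_prod_subtype_ne _ i, Fintype.prod_prod_type]
  congr 1
  cases b <;> simp [mul_comm]

section Restrict

variable {I : Type*} {i : I}

theorem exists_glued_restrict_iff {flip : X → X} {e : I × Bool → X} {κ : {j // j ≠ i} × Bool}
    (hκ : ∀ b, e (i, b) ≠ flip (e (κ.1, κ.2))) :
    (∃ κ', e κ' = flip (e (κ.1, κ.2))) ↔
      ∃ κ' : {j // j ≠ i} × Bool, e (κ'.1, κ'.2) = flip (e (κ.1, κ.2)) := by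
  constructor
  · rintro ⟨⟨j, b⟩, h⟩
    have hj : j ≠ i := by rintro rfl; exact hκ b h
    exact ⟨(⟨j, hj⟩, b), h⟩
  · rintro ⟨κ', h⟩
    exact ⟨_, h⟩

open Classical in
theorem chainFactor_restrict {flip : X → X} {e : I × Bool → X} {val : I × Bool → E → ℤ}
    {f : I × Bool → ℤ → ℝ≥0∞} {f' : {j // j ≠ i} × Bool → ℤ → ℝ≥0∞} {P : I → E}
    {κ : {j // j ≠ i} × Bool} (hκ : ∀ b, e (i, b) ≠ flip (e (κ.1, κ.2)))
    (hf : f' κ = f (κ.1, κ.2)) :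
    chainFactor flip e val f P (κ.1, κ.2) =
      chainFactor flip (fun κ : {j // j ≠ i} × Bool => e (κ.1, κ.2)) (fun κ => val (κ.1, κ.2)) f'
        (fun j => P j) κ := by
  unfold chainFactor
  rw [hf]
  refine if_congr (exists_glued_restrict_iff hκ) (if_congr ?_ rfl rfl) rfl
  constructor
  · exact fun h κ' h' => h _ h'
  · rintro h ⟨j, b⟩ h'
    have hj : j ≠ i := by rintro rfl; exact hκ b h'
    exact h (⟨j, hj⟩, b) h'

theorem chainNorm_restrict {flip : X → X} {e : I × Bool → X}
    {f : I × Bool → ℤ → ℝ≥0∞} {f' : {j // j ≠ i} × Bool → ℤ → ℝ≥0∞}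
    {κ : {j // j ≠ i} × Bool} (hκ : ∀ b, e (i, b) ≠ flip (e (κ.1, κ.2)))
    (hf : f' κ = f (κ.1, κ.2)) :
    chainNorm flip e f (κ.1, κ.2) =
      chainNorm flip (fun κ : {j // j ≠ i} × Bool => e (κ.1, κ.2)) f' κ := by
  unfold chainNorm
  rw [exists_glued_restrict_iff hκ, hf]

end Restrict

theorem chainFactor_of_not {I : Type*} {flip : X → X} {e : I × Bool → X}
    {val : I × Bool → E → ℤ} {f : I × Bool → ℤ → ℝ≥0∞} {P : I → E} {κ : I × Bool}
    (h : ∀ κ', e κ' ≠ flip (e κ)) : chainFactor flip e val f P κ = f κ (val κ (P κ.1)) :=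
  if_neg (by simpa using h)

theorem chainNorm_of_not {I : Type*} {flip : X → X} {e : I × Bool → X}
    {f : I × Bool → ℤ → ℝ≥0∞} {κ : I × Bool}
    (h : ∀ κ', e κ' ≠ flip (e κ)) : chainNorm flip e f κ = ∑' x, f κ x ^ 2 :=
  if_neg (by simpa using h)

theorem tsum_funSplitAt {I : Type*} [DecidableEq I] (i : I) (F : (I → E) → ℝ≥0∞) :
    ∑' P, F P = ∑' (P' : {j // j ≠ i} → E) (p : E), F ((Equiv.funSplitAt i E).symm (p, P')) := by
  rw [← (Equiv.funSplitAt i E).symm.tsum_eq, ENNReal.tsum_prod', ENNReal.tsum_comm]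

theorem funSplitAt_symm_same {I : Type*} [DecidableEq I] (i : I) (p : E) (P' : {j // j ≠ i} → E) :
    (Equiv.funSplitAt i E).symm (p, P') i = p := by
  simp [Equiv.funSplitAt_symm_apply]

theorem funSplitAt_symm_ne {I : Type*} [DecidableEq I] (i : I) (p : E) (P' : {j // j ≠ i} → E)
    (j : {j // j ≠ i}) : (Equiv.funSplitAt i E).symm (p, P') j = P' j := by
  simp [Equiv.funSplitAt_symm_apply, j.2]

/-- Nodes with two corners each are glued along chains that all end at boundary corners; if every
node acts as a bounded operator, the contraction of the chains is bounded. -/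
theorem chain_bound {K : ℝ≥0∞} {w : E → ℝ≥0∞} {flip : X → X} (hflip : Function.Involutive flip)
    (hne : ∀ x, flip x ≠ x) (n : ℕ) : ∀ (I : Type*) [Fintype I] (e : I × Bool → X)
    (val : I × Bool → E → ℤ) (f : I × Bool → ℤ → ℝ≥0∞), Fintype.card I = n →
    Function.Injective e →
    (∀ i b (u v : ℤ → ℝ≥0∞), (∑' p, w p * (u (val (i, b) p) * v (val (i, !b) p))) ^ 2
      ≤ K * ((∑' x, u x ^ 2) * ∑' x, v x ^ 2)) →
    (∀ i b (u : ℤ → ℝ≥0∞),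
      ∑' y, (∑' p, if val (i, !b) p = y then w p * u (val (i, b) p) else 0) ^ 2
        ≤ K * ∑' x, u x ^ 2) →
    (∀ J : Set I, J.Nonempty → ∃ i ∈ J, ∃ b, ∀ κ : I × Bool, κ.1 ∈ J → e κ ≠ flip (e (i, b))) →
    (∑' P : I → E, (∏ i, w (P i)) * ∏ κ, chainFactor flip e val f P κ) ^ 2
      ≤ K ^ n * ∏ κ, chainNorm flip e f κ := by
  classical
  induction n with
  | zero =>
    intro I _ e val f hI _ _ _ _
    have : IsEmpty I := Fintype.card_eq_zero_iff.1 hI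
    simp
  | succ n ih =>
    intro I _ e val f hI he H1 H2 HJ
    have : Nonempty I := Fintype.card_pos_iff.1 (by omega)
    obtain ⟨i, -, b, h0⟩ := HJ Set.univ Set.univ_nonempty
    replace h0 : ∀ κ, e κ ≠ flip (e (i, b)) := fun κ => h0 κ trivial
    have h0' : ∀ κ, e (i, b) ≠ flip (e κ) := fun κ h => h0 κ (by rw [h, hflip])
    have hcard : Fintype.card {j // j ≠ i} = n := by
      rw [Fintype.card_subtype_compl, Fintype.card_subtype_eq]; omega
    have he' : Function.Injective fun κ : {j // j ≠ i} × Bool => e (κ.1, κ.2) := by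
      rintro ⟨j, b⟩ ⟨j', b'⟩ h
      have := he h
      simp only [Prod.mk.injEq] at this
      exact Prod.ext (Subtype.ext this.1) this.2
    -- Openness is required of every subset of nodes, so it survives the removal of one node.
    have HJ' : ∀ J : Set {j // j ≠ i}, J.Nonempty → ∃ j ∈ J, ∃ b, ∀ κ : {j // j ≠ i} × Bool,
        κ.1 ∈ J → e (κ.1, κ.2) ≠ flip (e (j, b)) := by
      intro J hJ
      obtain ⟨_, ⟨j, hj, rfl⟩, b, h⟩ := HJ (Subtype.val '' J) (hJ.image _)
      exact ⟨j, hj, b, fun κ hκ => h (κ.1, κ.2) ⟨κ.1, hκ, rfl⟩⟩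
    have IH := fun f' => ih {j // j ≠ i} (fun κ => e (κ.1, κ.2)) (fun κ => val (κ.1, κ.2)) f' hcard
      he' (fun j b => H1 j b) (fun j b => H2 j b) HJ'
    have hb : ∀ b' κ, e (i, !b) ≠ flip (e κ) → e (i, b') ≠ flip (e κ) := by
      intro b' κ h
      rcases eq_or_ne b' b with rfl | hb'
      · exact h0' κ
      · rwa [Bool.eq_not_of_ne hb']
    rw [tsum_funSplitAt i]
    simp only [Fintype.prod_eq_mul_prod_subtype_ne _ i, prod_prod_bool _ i b,
      funSplitAt_symm_same, funSplitAt_symm_ne]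
    by_cases h1 : ∃ κ, e κ = flip (e (i, !b))
    · obtain ⟨⟨j, b'⟩, hj⟩ := h1
      have hji : j ≠ i := by
        rintro rfl
        rcases eq_or_ne b' b with rfl | hb'
        · exact h0' _ hj
        · rw [Bool.eq_not_of_ne hb'] at hj
          exact hne _ hj.symm
      set κ₁ : {j // j ≠ i} × Bool := (⟨j, hji⟩, b') with hκ₁
      have hother : ∀ κ : {j // j ≠ i} × Bool, κ ≠ κ₁ →
          ∀ b', e (i, b') ≠ flip (e (κ.1, κ.2)) := by
        intro κ hκ b''
        refine hb b'' _ fun h => hκ (he' ?_)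
        simp only [hκ₁]
        rw [hj, h, hflip]
      -- Once the end node `i` is removed, its neighbour `κ₁` becomes a boundary corner.
      have hend : ∀ κ : {j // j ≠ i} × Bool, e (κ.1, κ.2) ≠ flip (e (κ₁.1, κ₁.2)) := by
        intro κ h
        simp only [hκ₁] at h
        rw [hj, hflip] at h
        exact κ.1.2 (congrArg Prod.fst (he h))
      -- The image of the boundary vector under the operator of node `i`, used as the new boundary
      -- weight at `κ₁`.
      set u : ℤ → ℝ≥0∞ := fun y =>
        ∑' p, if val (i, !b) p = y then w p * f (i, b) (val (i, b) p) else 0 with hu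
      set f' : {j // j ≠ i} × Bool → ℤ → ℝ≥0∞ :=
        Function.update (fun κ => f (κ.1, κ.2)) κ₁ u with hf'
      have hf'1 : f' κ₁ = u := Function.update_self ..
      have hf'2 : ∀ κ, κ ≠ κ₁ → f' κ = f (κ.1, κ.2) := fun κ hκ => Function.update_of_ne hκ ..
      refine le_trans (pow_le_pow_left' ?_ 2) ((IH f').trans ?_)
      · refine ENNReal.tsum_le_tsum fun P' => ?_
        rw [← Finset.mul_prod_erase Finset.univ _ (Finset.mem_univ κ₁), chainFactor_of_not hend,
          hf'1, hu]
        simp only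
        rw [← mul_assoc, mul_comm _ (∑' _, _), mul_assoc, ← ENNReal.tsum_mul_right]
        refine ENNReal.tsum_le_tsum fun p => ?_
        set P := (Equiv.funSplitAt i E).symm (p, P') with hP
        have hPi : P i = p := funSplitAt_symm_same ..
        have hPj : ∀ j : {j // j ≠ i}, P j = P' j := funSplitAt_symm_ne i p P'
        have e1 : ∏ κ : {j // j ≠ i} × Bool, chainFactor flip e val f P (κ.1, κ.2)
            ≤ ∏ κ ∈ Finset.univ.erase κ₁, chainFactor flip
              (fun κ : {j // j ≠ i} × Bool => e (κ.1, κ.2)) (fun κ => val (κ.1, κ.2)) f' P' κ := by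
          rw [← Finset.mul_prod_erase Finset.univ _ (Finset.mem_univ κ₁)]
          -- The gluing constraint occurs at both of the glued corners. The copy at `κ₁` is
          -- discarded and the one at `(i, !b)` is kept.
          refine (mul_le_mul' (chainFactor_le_one ?_) le_rfl).trans ?_
          · exact ⟨(i, !b), by simp only [hκ₁]; rw [hj, hflip]⟩
          · rw [one_mul]
            refine Finset.prod_le_prod' fun κ hκ => le_of_eq ?_
            rw [chainFactor_restrict (hother κ (Finset.ne_of_mem_erase hκ))
              (hf'2 κ (Finset.ne_of_mem_erase hκ))]
            simp only [hPj]
        have e2 : chainFactor flip e val f P (i, !b)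
            ≤ if val (i, !b) p = val (κ₁.1, κ₁.2) (P' κ₁.1) then 1 else 0 := by
          unfold chainFactor
          rw [if_pos ⟨_, hj⟩]
          split_ifs with h2 h3
          · exact le_rfl
          · refine absurd ?_ h3
            have := h2 _ hj
            rwa [hPi, show P j = P' κ₁.1 from hPj κ₁.1] at this
          · exact zero_le
          · exact le_rfl
        rw [chainFactor_of_not h0, hPi]
        refine (mul_le_mul' le_rfl (mul_le_mul' (mul_le_mul' le_rfl e2) e1)).trans_eq ?_
        split_ifs <;> ring
      · have e1 : ∏ κ : {j // j ≠ i} × Bool, chainNorm flip e f (κ.1, κ.2)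
            = ∏ κ ∈ Finset.univ.erase κ₁, chainNorm flip
              (fun κ : {j // j ≠ i} × Bool => e (κ.1, κ.2)) f' κ := by
          rw [← Finset.mul_prod_erase Finset.univ _ (Finset.mem_univ κ₁)]
          have : chainNorm flip e f (κ₁.1, κ₁.2) = 1 :=
            if_pos ⟨(i, !b), by simp only [hκ₁]; rw [hj, hflip]⟩
          rw [this, one_mul]
          refine Finset.prod_congr rfl fun κ hκ => ?_
          rw [chainNorm_restrict (hother κ (Finset.ne_of_mem_erase hκ))
              (hf'2 κ (Finset.ne_of_mem_erase hκ))]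
        have e2 : chainNorm flip e f (i, !b) = 1 := if_pos ⟨_, hj⟩
        rw [← Finset.mul_prod_erase Finset.univ _ (Finset.mem_univ κ₁), chainNorm_of_not hend,
          hf'1, e1, e2, chainNorm_of_not h0, mul_one, pow_succ, mul_assoc, ← mul_assoc K]
        gcongr
        exact H2 i b _
    -- Both corners are free: the node decouples and contributes a scalar, bounded by `H1`.
    · push Not at h1
      have h1' : ∀ κ, e (i, !b) ≠ flip (e κ) := fun κ h => h1 κ (by rw [h, hflip])
      have hother : ∀ κ : {j // j ≠ i} × Bool, ∀ b', e (i, b') ≠ flip (e (κ.1, κ.2)) :=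
        fun κ b' => hb b' _ (h1' _)
      set f' : {j // j ≠ i} × Bool → ℤ → ℝ≥0∞ := fun κ => f (κ.1, κ.2) with hf'
      calc _ = ((∑' p, w p * (f (i, b) (val (i, b) p) * f (i, !b) (val (i, !b) p))) *
            ∑' P' : {j // j ≠ i} → E, (∏ j, w (P' j)) * ∏ κ, chainFactor flip
              (fun κ : {j // j ≠ i} × Bool => e (κ.1, κ.2)) (fun κ => val (κ.1, κ.2)) f' P' κ)
                ^ 2 := by
            rw [← ENNReal.tsum_mul_left]
            congr 1
            refine tsum_congr fun P' => ?_
            rw [← ENNReal.tsum_mul_right]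
            refine tsum_congr fun p => ?_
            rw [chainFactor_of_not h0, chainFactor_of_not h1, funSplitAt_symm_same]
            have : ∀ κ : {j // j ≠ i} × Bool, chainFactor flip e val f
                ((Equiv.funSplitAt i E).symm (p, P')) (κ.1, κ.2) = chainFactor flip
              (fun κ : {j // j ≠ i} × Bool => e (κ.1, κ.2)) (fun κ => val (κ.1, κ.2)) f' P' κ := by
              intro κ
              rw [chainFactor_restrict (hother κ) (f' := f') rfl]
              simp only [funSplitAt_symm_ne]
            simp only [this]
            ring
        _ ≤ (K * ((∑' x, f (i, b) x ^ 2) * ∑' x, f (i, !b) x ^ 2)) *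
            (K ^ n * ∏ κ, chainNorm flip
              (fun κ : {j // j ≠ i} × Bool => e (κ.1, κ.2)) f' κ) := by
            rw [mul_pow]
            exact mul_le_mul' (H1 i b _ _) (IH f')
        _ = _ := by
            rw [chainNorm_of_not h0, chainNorm_of_not h1]
            have : ∀ κ : {j // j ≠ i} × Bool, chainNorm flip e f (κ.1, κ.2) = chainNorm flip
              (fun κ : {j // j ≠ i} × Bool => e (κ.1, κ.2)) f' κ :=
              fun κ => chainNorm_restrict (hother κ) rfl
            simp only [this]
            ring

theorem tsum_pi_prod (g : E → ℝ≥0∞) (n : ℕ) : ∀ (I : Type*) [Fintype I],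
    Fintype.card I = n → ∑' P : I → E, ∏ i, g (P i) = (∑' p, g p) ^ n := by
  classical
  induction n with
  | zero =>
    intro I _ hI
    have : IsEmpty I := Fintype.card_eq_zero_iff.1 hI
    simp
  | succ n ih =>
    intro I _ hI
    have : Nonempty I := Fintype.card_pos_iff.1 (by omega)
    obtain ⟨i⟩ := this
    have hcard : Fintype.card {j // j ≠ i} = n := by
      rw [Fintype.card_subtype_compl, Fintype.card_subtype_eq]; omega
    rw [tsum_funSplitAt i]
    simp only [Fintype.prod_eq_mul_prod_subtype_ne _ i, funSplitAt_symm_same, funSplitAt_symm_ne]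
    simp_rw [ENNReal.tsum_mul_right, ENNReal.tsum_mul_left]
    rw [ih _ hcard, pow_succ, mul_comm]

end Chain

/-! ### A lower bound for the divergence degree -/

namespace FeynmanGraph

variable {V L : Type*} (G : FeynmanGraph V L)

/-- The color of a face. -/
def faceColor : G.Face → Fin 6 := Quot.lift (fun y => y.2) fun _ _ h => h.1

theorem faceColor_face (ℓ : L) (c : Fin 6) : G.faceColor (G.face ℓ c) = c := rfl

/-- A strand of a face. -/
noncomputable def faceStrand (f : G.Face) : L × Fin 6 := Quot.out f

theorem face_faceStrand (f : G.Face) : G.face (G.faceStrand f).1 (G.faceStrand f).2 = f :=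
  Quot.out_eq f

open Classical in
/-- The value on the strand `y` of a family of vectors `x s`, `s : S`, when the line `ℓ` of `H`
carries the vector numbered `ν ℓ` and the other lines carry zero. -/
noncomputable def strandValue {S : Type*} (H : Finset L) (ν : {ℓ // ℓ ∈ H} → S) (y : L × Fin 6) :
    (S × Fin 6 → ℚ) →ₗ[ℚ] ℚ :=
  if h : y.1 ∈ H then LinearMap.proj (ν ⟨y.1, h⟩, y.2) else 0

theorem strandValue_of_mem {S : Type*} {H : Finset L} (ν : {ℓ // ℓ ∈ H} → S) {ℓ : L} (h : ℓ ∈ H)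
    (c : Fin 6) (x : S × Fin 6 → ℚ) : strandValue H ν (ℓ, c) x = x (ν ⟨ℓ, h⟩, c) := by
  simp [strandValue, h]

theorem strandValue_of_notMem {S : Type*} {H : Finset L} (ν : {ℓ // ℓ ∈ H} → S) {ℓ : L}
    (h : ℓ ∉ H) (c : Fin 6) (x : S × Fin 6 → ℚ) : strandValue H ν (ℓ, c) x = 0 := by
  simp [strandValue, h]

/-- A lower bound for the divergence degree of `H`: the kernel of the incidence matrix contains the
families of vectors carried by the lines that are constant along faces, vanish on open faces and
sum to zero on each line. -/
theorem five_mul_card_le_divergenceDegree [Finite L] (H : Finset L) {S Q : Type*} [Fintype S]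
    [Fintype Q] (ν : {ℓ // ℓ ∈ H} → S) (hν : Function.Surjective ν)
    (T : (S × Fin 6 → ℚ) →ₗ[ℚ] (Q → ℚ))
    (hstep : ∀ x, T x = 0 → ∀ y z, G.FaceStep y z → strandValue H ν y x = strandValue H ν z x)
    (hopen : ∀ x, T x = 0 → ∀ y, ¬((∃ z, G.FaceStep y z) ∧ ∃ z, G.FaceStep z y) →
      strandValue H ν y x = 0) :
    (5 * Fintype.card S : ℤ) ≤ Fintype.card Q + 2 * H.card + G.divergenceDegree H := by
  classical
  set U : (S × Fin 6 → ℚ) →ₗ[ℚ] (S → ℚ) :=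
    LinearMap.pi fun s => ∑ c : Fin 6, LinearMap.proj (s, c) with hU
  set Φ := T.prod U with hΦ
  have hker : ∀ x ∈ LinearMap.ker Φ, T x = 0 ∧ ∀ s, ∑ c, x (s, c) = 0 := by
    intro x hx
    replace hx : (T x, U x) = 0 := hx
    rw [Prod.mk_eq_zero] at hx
    refine ⟨hx.1, fun s => ?_⟩
    have := congrFun hx.2 s
    simpa [hU] using this
  set A := G.incidence H with hA
  set Ψ : (S × Fin 6 → ℚ) →ₗ[ℚ] ({f // f ∈ G.internalFaces H} → ℚ) :=
    LinearMap.pi fun f => strandValue H ν (G.faceStrand f.1) with hΨ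
  have hface : ∀ x, T x = 0 → ∀ ℓ c, strandValue H ν (G.faceStrand (G.face ℓ c)) x
      = strandValue H ν (ℓ, c) x := by
    intro x hx ℓ c
    have : ∀ f : G.Face, ∀ y, Quot.mk _ y = f → Quot.lift (fun y => strandValue H ν y x)
        (fun y z h => hstep x hx y z h) f = strandValue H ν y x := by
      rintro f y rfl; rfl
    rw [← this _ _ (G.face_faceStrand (G.face ℓ c)), ← this (G.face ℓ c) (ℓ, c) rfl]
  have hzero : ∀ x, T x = 0 → ∀ ℓ c, G.face ℓ c ∉ G.internalFaces H →
      strandValue H ν (ℓ, c) x = 0 := by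
    intro x hx ℓ c h
    simp only [internalFaces, Finset.mem_filter, Finset.mem_univ, true_and, not_and_or] at h
    rcases h with h | h
    · simp only [IsInternal, not_forall] at h
      obtain ⟨ℓ', c', hf, h⟩ := h
      rw [← hface x hx, ← hf, hface x hx]
      exact hopen x hx _ h
    · simp only [not_forall] at h
      obtain ⟨ℓ', c', hf, h⟩ := h
      rw [← hface x hx, ← hf, hface x hx]
      exact strandValue_of_notMem ν h _ _
  have hmaps : ∀ x ∈ LinearMap.ker Φ, Ψ x ∈ LinearMap.ker A.mulVecLin := by
    intro x hx
    obtain ⟨hT, hS⟩ := hker x hx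
    rw [LinearMap.mem_ker]
    ext ℓ
    rw [Matrix.mulVecLin_apply, Matrix.mulVec, dotProduct, Pi.zero_apply]
    have e1 : ∀ f : {f // f ∈ G.internalFaces H}, A ℓ f * Ψ x f
        = ∑ c, if G.face ℓ.1 c = f.1 then strandValue H ν (ℓ.1, c) x else 0 := by
      intro f
      simp only [hA, incidence, hΨ, LinearMap.pi_apply]
      split_ifs with h
      · obtain ⟨c, hc⟩ := h
        rw [Finset.sum_eq_single c, if_pos hc, ← hface x hT ℓ.1 c, hc, one_mul]
        · intro c' _ hc'
          rw [if_neg]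
          intro h
          exact hc' (by rw [← G.faceColor_face ℓ.1 c', h, ← hc, G.faceColor_face])
        · simp
      · rw [zero_mul, Finset.sum_eq_zero]
        intro c _
        rw [if_neg fun h' => h ⟨c, h'⟩]
    simp_rw [e1]
    rw [Finset.sum_comm]
    refine Eq.trans ?_ (hS (ν ℓ))
    refine Finset.sum_congr rfl fun c _ => ?_
    rw [← strandValue_of_mem ν ℓ.2 c x]
    by_cases hc : G.face ℓ.1 c ∈ G.internalFaces H
    · rw [Finset.sum_eq_single ⟨_, hc⟩]
      · simp
      · intro f _ hf
        rw [if_neg fun h => hf (Subtype.ext h.symm)]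
      · simp
    · rw [hzero x hT _ _ hc]
      simp
  -- Each coordinate of `x` is read on some line, where it is either a value of `Ψ x` or zero.
  have hinj : Function.Injective (Ψ.restrict hmaps) := by
    rw [← LinearMap.ker_eq_bot, LinearMap.ker_eq_bot']
    rintro ⟨x, hx⟩ h
    obtain ⟨hT, hS⟩ := hker x hx
    have h' : Ψ x = 0 := congrArg Subtype.val h
    refine Subtype.ext (funext fun ⟨s, c⟩ => ?_)
    obtain ⟨ℓ, rfl⟩ := hν s
    change x (ν ℓ, c) = 0
    rw [← strandValue_of_mem ν ℓ.2 c x]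
    by_cases hc : G.face ℓ.1 c ∈ G.internalFaces H
    · have := congrFun h' ⟨_, hc⟩
      rwa [hΨ, LinearMap.pi_apply, hface x hT] at this
    · exact hzero x hT _ _ hc
  -- The kernel of `Φ` has dimension at least `6|S| - |Q| - |S|`, and that of `A` has dimension `F -
  -- R = ω + 2 L`.
  have h1 := LinearMap.finrank_le_finrank_of_injective hinj
  have h2 := LinearMap.finrank_range_add_finrank_ker Φ
  have h3 := LinearMap.finrank_range_add_finrank_ker A.mulVecLin
  have h4 := Submodule.finrank_le (LinearMap.range Φ)
  simp only [Module.finrank_prod, Module.finrank_fintype_fun_eq_card, Fintype.card_prod,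
    Fintype.card_fin, Fintype.card_coe] at h2 h3 h4
  rw [divergenceDegree, ← hA, Matrix.rank]
  omega

end FeynmanGraph

/-! ### Nodes and the consequences of complete convergence -/

namespace FeynmanGraph

/-- The other half-line of the same type in a bubble. -/
def opposite {V : Type*} (x : V × Bool) : V × Bool := (x.1, !x.2)

theorem opposite_involutive {V : Type*} : Function.Involutive (opposite : V × Bool → V × Bool) :=
  fun x => by simp [opposite]

theorem opposite_ne {V : Type*} (x : V × Bool) : opposite x ≠ x := fun h => by
  have := congrArg Prod.snd h
  simp [opposite] at this

variable {V L : Type*} (G : FeynmanGraph V L)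

/-- The line `ℓ` is followed by the line `ℓ'` along the corners of the bubbles. -/
def LineStep (ℓ ℓ' : L) : Prop := G.tgt ℓ = G.src ℓ'

variable {G} in
theorem LineStep.right_unique {ℓ ℓ₁ ℓ₂ : L} (h₁ : G.LineStep ℓ ℓ₁) (h₂ : G.LineStep ℓ ℓ₂) :
    ℓ₁ = ℓ₂ := G.src_injective (h₁.symm.trans h₂)

variable {G} in
theorem LineStep.left_unique {ℓ ℓ₁ ℓ₂ : L} (h₁ : G.LineStep ℓ₁ ℓ) (h₂ : G.LineStep ℓ₂ ℓ) :
    ℓ₁ = ℓ₂ := G.tgt_injective (Eq.trans h₁ (Eq.symm h₂))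

theorem faceStep_of_ne {ℓ ℓ' : L} {c : Fin 6} (h : c ≠ G.color (G.tgt ℓ).1) :
    G.FaceStep (ℓ, c) (ℓ', c) ↔ G.LineStep ℓ ℓ' := by
  simp [FaceStep, strand, h, LineStep]

theorem faceStep_of_eq {ℓ ℓ' : L} {c : Fin 6} (h : c = G.color (G.tgt ℓ).1) :
    G.FaceStep (ℓ, c) (ℓ', c) ↔ opposite (G.tgt ℓ) = G.src ℓ' := by
  simp [FaceStep, strand, h, opposite]

theorem reachable_src_tgt {H : Set L} {ℓ : L} (h : ℓ ∈ H) :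
    (G.lineGraph H).Reachable (G.src ℓ).1 (G.tgt ℓ).1 := by
  by_cases he : (G.src ℓ).1 = (G.tgt ℓ).1
  · rw [he]
  · exact SimpleGraph.Adj.reachable
      ((SimpleGraph.fromRel_adj _ _ _).2 ⟨he, Or.inl ⟨ℓ, h, rfl, rfl⟩⟩)

variable {G} in
/-- In a completely convergent graph, a cycle of lines whose bubbles all have the same special
color has length at least three. -/
theorem IsCompletelyConvergent.three_le_card_of_forall_color_eq [Finite L]
    (hG : G.IsCompletelyConvergent) {H : Finset L} (hH : G.IsConnectedSubgraph H) {c₀ : Fin 6}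
    (hc : ∀ ℓ ∈ H, G.color (G.tgt ℓ).1 = c₀)
    (hnext : ∀ ℓ ∈ H, ∃ ℓ' ∈ H, G.LineStep ℓ ℓ') (hprev : ∀ ℓ ∈ H, ∃ ℓ' ∈ H, G.LineStep ℓ' ℓ) :
    3 ≤ H.card := by
  have hω := hG H hH
  obtain ⟨ℓ₀, hℓ₀⟩ := hH.1
  -- All lines carry one common vector. Only the color `c₀` can leave the cycle, so a single
  -- equation suffices, and `5 ≤ 1 + 2 L + ω` with `ω ≤ -1` gives `L ≥ 3`.
  set T : (Unit × Fin 6 → ℚ) →ₗ[ℚ] (Unit → ℚ) := LinearMap.pi fun _ => LinearMap.proj ((), c₀)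
    with hT
  have hT' : ∀ x, T x = 0 → x ((), c₀) = 0 := fun x hx => congrFun hx ()
  have hcol : ∀ ℓ ℓ', G.src ℓ' = opposite (G.tgt ℓ) → ℓ' ∈ H → G.color (G.tgt ℓ).1 = c₀ := by
    intro ℓ ℓ' h h'
    obtain ⟨ℓ'', h2, h3⟩ := hprev ℓ' h'
    rw [← hc ℓ'' h2, show G.tgt ℓ'' = G.src ℓ' from h3, h]
    rfl
  have key := G.five_mul_card_le_divergenceDegree H (S := Unit) (Q := Unit) (fun _ => ())
    (fun _ => ⟨⟨ℓ₀, hℓ₀⟩, rfl⟩) T ?_ ?_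
  · simp only [Fintype.card_unit] at key
    omega
  · rintro x hx ⟨ℓ, c⟩ ⟨ℓ', c'⟩ h
    obtain rfl : c = c' := h.1
    by_cases hcc : c = G.color (G.tgt ℓ).1
    · have hzero : ∀ ℓ₁, G.color (G.tgt ℓ).1 = c₀ →
          strandValue H (fun _ => ()) (ℓ₁, c) x = 0 := by
        intro ℓ₁ h₁
        by_cases h₂ : ℓ₁ ∈ H
        · rw [strandValue_of_mem _ h₂, hcc, h₁]
          exact hT' x hx
        · rw [strandValue_of_notMem _ h₂]
      rw [G.faceStep_of_eq hcc] at h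
      by_cases hℓ : ℓ ∈ H
      · rw [hzero _ (hc ℓ hℓ), hzero _ (hc ℓ hℓ)]
      · by_cases hℓ' : ℓ' ∈ H
        · rw [hzero _ (hcol ℓ ℓ' h.symm hℓ'), hzero _ (hcol ℓ ℓ' h.symm hℓ')]
        · rw [strandValue_of_notMem _ hℓ, strandValue_of_notMem _ hℓ']
    · rw [G.faceStep_of_ne hcc] at h
      have hiff : ℓ ∈ H ↔ ℓ' ∈ H := by
        constructor
        · intro hℓ
          obtain ⟨ℓ₁, h₁, h₂⟩ := hnext ℓ hℓ
          rwa [← h₂.right_unique h]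
        · intro hℓ
          obtain ⟨ℓ₁, h₁, h₂⟩ := hprev ℓ' hℓ
          rwa [← h₂.left_unique h]
      by_cases hℓ : ℓ ∈ H
      · rw [strandValue_of_mem _ hℓ, strandValue_of_mem _ (hiff.1 hℓ)]
      · rw [strandValue_of_notMem _ hℓ, strandValue_of_notMem _ (mt hiff.2 hℓ)]
  · rintro x hx ⟨ℓ, c⟩ h
    by_cases hℓ : ℓ ∈ H
    · by_cases hcc : c = c₀
      · rw [strandValue_of_mem _ hℓ, hcc]
        exact hT' x hx
      · refine absurd ?_ h
        obtain ⟨ℓ₁, h₁, h₂⟩ := hnext ℓ hℓ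
        obtain ⟨ℓ₂, h₃, h₄⟩ := hprev ℓ hℓ
        exact ⟨⟨(ℓ₁, c), (G.faceStep_of_ne (by rwa [hc ℓ hℓ])).2 h₂⟩,
          ⟨(ℓ₂, c), (G.faceStep_of_ne (by rwa [hc ℓ₂ h₃])).2 h₄⟩⟩
    · rw [strandValue_of_notMem _ hℓ]

open Classical in
/-- A closed ring of cycles of length two is not convergent. -/
theorem divergenceDegree_nonneg_of_ring [Finite L] {I : Type*} [Fintype I] {lam : I × Bool → L}
    (hlam : Function.Injective lam) (hstep : ∀ i b, G.LineStep (lam (i, b)) (lam (i, !b)))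
    (hglue : ∀ κ, ∃ κ', G.tgt (lam κ') = opposite (G.tgt (lam κ))) :
    0 ≤ G.divergenceDegree (Finset.univ.image lam) := by
  choose β hβ using hglue
  have hinj : Function.Injective fun κ => G.tgt (lam κ) := G.tgt_injective.comp hlam
  have hββ : ∀ κ, β (β κ) = κ := fun κ => hinj (by simp only [hβ]; exact opposite_involutive _)
  set H := Finset.univ.image lam with hH
  have hmem : ∀ κ, lam κ ∈ H := fun κ => Finset.mem_image_of_mem _ (Finset.mem_univ _)
  have hex : ∀ ℓ : {ℓ // ℓ ∈ H}, ∃ κ, lam κ = ℓ.1 := fun ℓ => by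
    obtain ⟨κ, -, h⟩ := Finset.mem_image.1 ℓ.2
    exact ⟨κ, h⟩
  choose ν' hν' using hex
  set ν : {ℓ // ℓ ∈ H} → I := fun ℓ => (ν' ℓ).1 with hν
  have hνlam : ∀ κ, ν ⟨lam κ, hmem κ⟩ = κ.1 := fun κ => by
    rw [hν]; simp only; rw [hlam (hν' ⟨lam κ, hmem κ⟩)]
  have hval : ∀ κ c x, strandValue H ν (lam κ, c) x = x (κ.1, c) := fun κ c x => by
    rw [strandValue_of_mem _ (hmem κ), hνlam]
  have hcardH : H.card = 2 * Fintype.card I := by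
    rw [hH, Finset.card_image_of_injective _ hlam, Finset.card_univ, Fintype.card_prod,
      Fintype.card_bool, mul_comm]
  -- Gluing pairs each corner numbered `true` with one numbered `false`, so one equation per pair
  -- makes as many equations as nodes. The dimension count is then `5n ≤ n + 2 · 2n + ω`.
  have hQ : 2 * Fintype.card {κ // (G.tgt (lam κ)).2 = true} = 2 * Fintype.card I := by
    have h1 : Fintype.card {κ // (G.tgt (lam κ)).2 = true}
        = Fintype.card {κ // ¬ (G.tgt (lam κ)).2 = true} := Fintype.card_congr
      { toFun := fun κ => ⟨β κ, by rw [hβ]; simp [opposite, κ.2]⟩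
        invFun := fun κ => ⟨β κ, by rw [hβ]; simpa [opposite] using κ.2⟩
        left_inv := fun κ => Subtype.ext (hββ κ)
        right_inv := fun κ => Subtype.ext (hββ κ) }
    have h2 := Fintype.card_subtype_compl fun κ => (G.tgt (lam κ)).2 = true
    have h3 := Fintype.card_subtype_le fun κ => (G.tgt (lam κ)).2 = true
    rw [Fintype.card_prod, Fintype.card_bool] at h2 h3
    omega
  set T : (I × Fin 6 → ℚ) →ₗ[ℚ] ({κ // (G.tgt (lam κ)).2 = true} → ℚ) := LinearMap.pi fun κ =>
    (LinearMap.proj (κ.1.1, G.color (G.tgt (lam κ)).1) : (I × Fin 6 → ℚ) →ₗ[ℚ] ℚ)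
      - LinearMap.proj ((β κ).1, G.color (G.tgt (lam κ)).1) with hT
  have hT' : ∀ x, T x = 0 → ∀ κ, x (κ.1, G.color (G.tgt (lam κ)).1)
      = x ((β κ).1, G.color (G.tgt (lam κ)).1) := by
    intro x hx
    have h1 : ∀ κ, (G.tgt (lam κ)).2 = true → x (κ.1, G.color (G.tgt (lam κ)).1)
      = x ((β κ).1, G.color (G.tgt (lam κ)).1) := fun κ hκ =>
        sub_eq_zero.1 (congrFun hx ⟨κ, hκ⟩)
    intro κ
    by_cases hκ : (G.tgt (lam κ)).2 = true
    · exact h1 κ hκ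
    · have h2 := h1 (β κ) (by rw [hβ]; simpa [opposite] using hκ)
      rw [hββ, hβ] at h2
      exact h2.symm
  have hpred : ∀ i b, G.LineStep (lam (i, !b)) (lam (i, b)) := fun i b => by
    have := hstep i (!b)
    rwa [Bool.not_not] at this
  have hnext : ∀ κ, opposite (G.tgt (lam κ)) = G.src (lam ((β κ).1, !(β κ).2)) := fun κ => by
    rw [← hβ]; exact hstep _ _
  have key := G.five_mul_card_le_divergenceDegree H ν
    (fun i => ⟨⟨lam (i, true), hmem _⟩, hνlam _⟩) T ?_ ?_
  · omega
  · rintro x hx ⟨ℓ, c⟩ ⟨ℓ', c'⟩ h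
    obtain rfl : c = c' := h.1
    by_cases hcc : c = G.color (G.tgt ℓ).1
    · rw [G.faceStep_of_eq hcc] at h
      by_cases hℓ : ∃ κ, lam κ = ℓ
      · obtain ⟨κ, rfl⟩ := hℓ
        have : ℓ' = lam ((β κ).1, !(β κ).2) := G.src_injective (by rw [← h, hnext])
        rw [this, hval, hval, hcc]
        exact hT' x hx κ
      · by_cases hℓ' : ∃ κ, lam κ = ℓ'
        · obtain ⟨κ, rfl⟩ := hℓ'
          refine absurd ⟨β (κ.1, !κ.2), G.tgt_injective ?_⟩ hℓ
          rw [hβ, show G.tgt (lam (κ.1, !κ.2)) = G.src (lam κ) from hpred κ.1 κ.2, ← h]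
          exact opposite_involutive _
        · rw [strandValue_of_notMem _ (by simpa [hH] using hℓ),
            strandValue_of_notMem _ (by simpa [hH] using hℓ')]
    · rw [G.faceStep_of_ne hcc] at h
      by_cases hℓ : ∃ κ, lam κ = ℓ
      · obtain ⟨κ, rfl⟩ := hℓ
        rw [h.right_unique (hstep κ.1 κ.2), hval, hval]
      · by_cases hℓ' : ∃ κ, lam κ = ℓ'
        · obtain ⟨κ, rfl⟩ := hℓ'
          exact absurd ⟨_, (hpred κ.1 κ.2).left_unique h⟩ hℓ
        · rw [strandValue_of_notMem _ (by simpa [hH] using hℓ),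
            strandValue_of_notMem _ (by simpa [hH] using hℓ')]
  · rintro x hx ⟨ℓ, c⟩ h
    by_cases hℓ : ∃ κ, lam κ = ℓ
    · obtain ⟨κ, rfl⟩ := hℓ
      refine absurd ⟨?_, ?_⟩ h
      · by_cases hcc : c = G.color (G.tgt (lam κ)).1
        · exact ⟨(_, c), (G.faceStep_of_eq hcc).2 (hnext κ)⟩
        · exact ⟨(_, c), (G.faceStep_of_ne hcc).2 (hstep κ.1 κ.2)⟩
      · have hp : G.tgt (lam (κ.1, !κ.2)) = G.src (lam κ) := hpred κ.1 κ.2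
        by_cases hcc : c = G.color (G.tgt (lam (κ.1, !κ.2))).1
        · refine ⟨(lam (β (κ.1, !κ.2)), c), (G.faceStep_of_eq ?_).2 ?_⟩
          · rw [hβ]; exact hcc
          · rw [hβ, opposite_involutive, hp]
        · exact ⟨(_, c), (G.faceStep_of_ne hcc).2 (hpred κ.1 κ.2)⟩
    · rw [strandValue_of_notMem _ (by simpa [hH] using hℓ)]

variable {G} in
/-- In a completely convergent graph, the chains of cycles of length two are open. -/
theorem IsCompletelyConvergent.exists_boundary [Finite L] (hG : G.IsCompletelyConvergent)
    {I : Type*} [Finite I] {lam : I × Bool → L} (hlam : Function.Injective lam)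
    (hstep : ∀ i b, G.LineStep (lam (i, b)) (lam (i, !b))) {J : Set I} (hJ : J.Nonempty) :
    ∃ i ∈ J, ∃ b, ∀ κ : I × Bool, κ.1 ∈ J → G.tgt (lam κ) ≠ opposite (G.tgt (lam (i, b))) := by
  classical
  by_contra! hcon
  obtain ⟨i₀, hi₀⟩ := hJ
  have hinj : Function.Injective fun κ => G.tgt (lam κ) := G.tgt_injective.comp hlam
  -- If every corner of `J` is glued inside `J`, the nodes reached from `i₀` form a connected ring,
  -- to which complete convergence applies.
  set R : I → I → Prop := fun i j => ∃ b b', G.tgt (lam (j, b')) = opposite (G.tgt (lam (i, b)))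
  have hmemJ : ∀ j, Relation.ReflTransGen R i₀ j → j ∈ J := by
    intro j hj
    induction hj with
    | refl => exact hi₀
    | tail _ h ih =>
      obtain ⟨b, b', h⟩ := h
      obtain ⟨κ, hκ, h'⟩ := hcon _ ih b
      rw [← h] at h'
      rwa [hinj h'] at hκ
  let S := {j // Relation.ReflTransGen R i₀ j}
  have : Fintype S := Fintype.ofFinite S
  set mu : S × Bool → L := fun κ => lam (κ.1, κ.2) with hmu
  have hmu_inj : Function.Injective mu := by
    rintro ⟨j, b⟩ ⟨j', b'⟩ h
    have := hlam h
    simp only [Prod.mk.injEq] at this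
    exact Prod.ext (Subtype.ext this.1) this.2
  have hω := G.divergenceDegree_nonneg_of_ring hmu_inj (fun i b => hstep i.1 b) (by
    rintro ⟨⟨j, hj⟩, b⟩
    obtain ⟨⟨k, b'⟩, -, h'⟩ := hcon j (hmemJ j hj) b
    exact ⟨(⟨k, hj.tail ⟨b, b', h'⟩⟩, b'), h'⟩)
  set H := Finset.univ.image mu with hH
  have hmem : ∀ κ, mu κ ∈ H := fun κ => Finset.mem_image_of_mem _ (Finset.mem_univ _)
  refine absurd (hG H ⟨⟨mu (⟨i₀, .refl⟩, true), hmem _⟩, ?_⟩) (not_lt.2 hω)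
  have hvert : ∀ (j : I) (hj : Relation.ReflTransGen R i₀ j) (b b' : Bool),
      (G.lineGraph H).Reachable (G.src (lam (j, b))).1 (G.tgt (lam (j, b'))).1 := by
    intro j hj b b'
    have h1 : ∀ b, (G.lineGraph H).Reachable (G.src (lam (j, b))).1 (G.tgt (lam (j, b))).1 :=
      fun b => G.reachable_src_tgt (hmem (⟨j, hj⟩, b))
    rcases eq_or_ne b' b with rfl | hb
    · exact h1 _
    · rw [Bool.eq_not_of_ne hb]
      have := h1 (!b)
      have h2 := h1 b
      rw [show G.tgt (lam (j, b)) = G.src (lam (j, !b)) from hstep j b] at h2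
      exact h2.trans this
  have hreach : ∀ j, Relation.ReflTransGen R i₀ j → ∀ b,
      (G.lineGraph H).Reachable (G.src (lam (i₀, true))).1 (G.src (lam (j, b))).1 := by
    intro j hj
    induction hj with
    | refl =>
      intro b
      exact (hvert i₀ .refl true true).trans (hvert i₀ .refl b true).symm
    | @tail j k hj h ih =>
      obtain ⟨b, b', h⟩ := h
      intro b''
      have h1 := hvert j hj true b
      have h2 := hvert k (hj.tail ⟨b, b', h⟩) b'' b'
      rw [h] at h2
      exact ((ih true).trans h1).trans h2.symm
  intro ℓ hℓ ℓ' hℓ'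
  obtain ⟨⟨j, b⟩, -, rfl⟩ := Finset.mem_image.1 hℓ
  obtain ⟨⟨k, b'⟩, -, rfl⟩ := Finset.mem_image.1 hℓ'
  exact (hreach j.1 j.2 b).symm.trans (hreach k.1 k.2 b')

/-- The nodes are the connected components of lines joined along the corners of the bubbles. -/
def Node : Type _ := Quot G.LineStep

/-- The node of a line. -/
def node (ℓ : L) : G.Node := Quot.mk _ ℓ

variable {G} in
theorem LineStep.node_eq {ℓ ℓ' : L} (h : G.LineStep ℓ ℓ') : G.node ℓ = G.node ℓ' := Quot.sound h

theorem node_surjective : Function.Surjective G.node := Quot.mk_surjective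

noncomputable instance [Finite L] : Fintype G.Node :=
  @Fintype.ofFinite _ (Finite.of_surjective _ G.node_surjective)

/-- A node is closed if each of its lines is continued at both ends. -/
def IsClosedNode (C : G.Node) : Prop :=
  ∀ ℓ, G.node ℓ = C → (∃ ℓ', G.LineStep ℓ ℓ') ∧ ∃ ℓ', G.LineStep ℓ' ℓ

open Classical in
/-- The lines of a node. -/
noncomputable def nodeLines [Fintype L] (C : G.Node) : Finset L := {ℓ | G.node ℓ = C}

theorem mem_nodeLines [Fintype L] {C : G.Node} {ℓ : L} : ℓ ∈ G.nodeLines C ↔ G.node ℓ = C := by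
  simp [nodeLines]

theorem nodeLines_nonempty [Fintype L] (C : G.Node) : (G.nodeLines C).Nonempty := by
  obtain ⟨ℓ, rfl⟩ := G.node_surjective C
  exact ⟨ℓ, G.mem_nodeLines.2 rfl⟩

theorem isConnectedSubgraph_nodeLines [Fintype L] (C : G.Node) :
    G.IsConnectedSubgraph (G.nodeLines C) := by
  refine ⟨G.nodeLines_nonempty C, fun ℓ hℓ ℓ' hℓ' => ?_⟩
  rw [mem_nodeLines] at hℓ hℓ'
  have h : Relation.EqvGen G.LineStep ℓ ℓ' := Quot.eqvGen_exact (hℓ.trans hℓ'.symm)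
  clear hℓ'
  induction h with
  | rel x y h =>
    have := G.reachable_src_tgt (H := G.nodeLines C) (G.mem_nodeLines.2 hℓ)
    rwa [show G.tgt x = G.src y from h] at this
  | refl x => exact SimpleGraph.Reachable.refl _
  | symm x y h ih =>
    exact (ih ((Quot.eqvGen_sound h).trans hℓ)).symm
  | trans x y z h _ ih1 ih2 =>
    exact (ih1 hℓ).trans (ih2 ((Quot.eqvGen_sound h).symm.trans hℓ))

variable {G} in
theorem IsCompletelyConvergent.three_le_card_nodeLines [Fintype L] (hG : G.IsCompletelyConvergent)
    {C : G.Node} (hC : G.IsClosedNode C) {c₀ : Fin 6}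
    (hc : ∀ ℓ ∈ G.nodeLines C, G.color (G.tgt ℓ).1 = c₀) : 3 ≤ (G.nodeLines C).card := by
  refine hG.three_le_card_of_forall_color_eq (G.isConnectedSubgraph_nodeLines C) hc ?_ ?_
  · intro ℓ hℓ
    rw [mem_nodeLines] at hℓ
    obtain ⟨ℓ', h⟩ := (hC ℓ hℓ).1
    exact ⟨ℓ', G.mem_nodeLines.2 (h.node_eq ▸ hℓ), h⟩
  · intro ℓ hℓ
    rw [mem_nodeLines] at hℓ
    obtain ⟨ℓ', h⟩ := (hC ℓ hℓ).2
    exact ⟨ℓ', G.mem_nodeLines.2 (h.node_eq.trans hℓ), h⟩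

variable {G} in
theorem IsCompletelyConvergent.two_le_card_nodeLines [Fintype L] (hG : G.IsCompletelyConvergent)
    {C : G.Node} (hC : G.IsClosedNode C) : 2 ≤ (G.nodeLines C).card := by
  by_contra! h
  have h1 := (G.nodeLines_nonempty C).card_pos
  obtain ⟨ℓ, hℓ⟩ := Finset.card_eq_one.1 (show (G.nodeLines C).card = 1 by omega)
  have := hG.three_le_card_nodeLines hC (c₀ := G.color (G.tgt ℓ).1) (by simp [hℓ])
  omega

variable {G} in
-- Steps are deterministic in both directions, so the property of being equal to `ℓ` is constant on
-- nodes.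
theorem LineStep.eq_of_self {ℓ ℓ' : L} (h : G.LineStep ℓ ℓ) (h' : G.node ℓ' = G.node ℓ) :
    ℓ' = ℓ := by
  have hresp : ∀ x y, G.LineStep x y → (x = ℓ) = (y = ℓ) := by
    intro x y hxy
    refine propext ⟨?_, ?_⟩
    · rintro rfl; exact hxy.right_unique h
    · rintro rfl; exact hxy.left_unique h
  have := congrArg (Quot.lift (fun x => x = ℓ) hresp) h'
  change (ℓ' = ℓ) = (ℓ = ℓ) at this
  rw [this]

variable {G} in
/-- The shape of the closed nodes with two lines. -/
theorem IsCompletelyConvergent.exists_two_cycle [Fintype L] (hG : G.IsCompletelyConvergent)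
    {C : G.Node} (hC : G.IsClosedNode C) (h2 : (G.nodeLines C).card = 2) :
    ∃ lam : Bool → L, Function.Injective lam ∧ (∀ ℓ, G.node ℓ = C ↔ ∃ b, lam b = ℓ) ∧
      (∀ b, G.LineStep (lam b) (lam (!b))) ∧
      ∀ b, G.color (G.tgt (lam b)).1 ≠ G.color (G.tgt (lam (!b))).1 := by
  classical
  obtain ⟨ℓ₀, ℓ₁, hne, hl⟩ := Finset.card_eq_two.1 h2
  have hmem : ∀ ℓ, G.node ℓ = C ↔ ℓ = ℓ₀ ∨ ℓ = ℓ₁ := fun ℓ => by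
    rw [← G.mem_nodeLines, hl]; simp
  have hstep : ∀ ℓ ℓ', ℓ ≠ ℓ' → G.node ℓ = C → G.node ℓ' = C →
      (∀ x, G.node x = C → x = ℓ ∨ x = ℓ') → G.LineStep ℓ ℓ' := by
    intro ℓ ℓ' hn h h' hall
    obtain ⟨x, hx⟩ := (hC ℓ h).1
    rcases hall x (hx.node_eq.symm.trans h) with rfl | rfl
    · exact absurd (hx.eq_of_self (h'.trans h.symm)).symm hn
    · exact hx
  have h0 := (hmem ℓ₀).2 (Or.inl rfl)
  have h1 := (hmem ℓ₁).2 (Or.inr rfl)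
  have hcol : G.color (G.tgt ℓ₀).1 ≠ G.color (G.tgt ℓ₁).1 := by
    intro h
    have := hG.three_le_card_nodeLines hC (c₀ := G.color (G.tgt ℓ₁).1) (by simp [hl, h])
    omega
  refine ⟨fun b => if b then ℓ₁ else ℓ₀, ?_, ?_, ?_, ?_⟩
  · intro b b'
    cases b <;> cases b' <;> simp [hne, hne.symm]
  · intro ℓ
    rw [hmem]
    simp [Bool.exists_bool, eq_comm]
  · intro b
    cases b
    · exact hstep ℓ₀ ℓ₁ hne h0 h1 fun x hx => (hmem x).1 hx
    · exact hstep ℓ₁ ℓ₀ hne.symm h1 h0 fun x hx => ((hmem x).1 hx).symm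
  · intro b
    cases b
    · exact hcol
    · exact hcol.symm

/-! ### Conservation of momentum along nodes -/

section Momenta

variable (pext : {f // ¬ G.IsInternal f} → ℤ)

/-- The momenta of the six strands of a line. -/
noncomputable def lineMomentum (q : {f // G.IsInternal f} → ℤ) (ℓ : L) (c : Fin 6) : ℤ :=
  G.faceMomentum pext q (G.face ℓ c)

/-- The internal momenta that satisfy the gauge constraint on each line. -/
def gaugeInvariant : Set ({f // G.IsInternal f} → ℤ) :=
  {q | ∀ ℓ, ∑ c, G.lineMomentum pext q ℓ c = 0}

variable {G pext} {q q' : {f // G.IsInternal f} → ℤ}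

theorem lineMomentum_eq_of_faceStep {ℓ ℓ' : L} {c : Fin 6} (h : G.FaceStep (ℓ, c) (ℓ', c)) :
    G.lineMomentum pext q ℓ c = G.lineMomentum pext q ℓ' c := by
  have : G.face ℓ c = G.face ℓ' c := Quot.sound h
  rw [lineMomentum, this, lineMomentum]

theorem lineMomentum_eq_of_not_isInternal {ℓ : L} {c : Fin 6} (h : ¬ G.IsInternal (G.face ℓ c)) :
    G.lineMomentum pext q ℓ c = G.lineMomentum pext q' ℓ c := by
  simp [lineMomentum, faceMomentum, h]

theorem eq_of_sum_eq_zero {p p' : Fin 6 → ℤ} (hp : ∑ c, p c = 0) (hp' : ∑ c, p' c = 0) {c₀ : Fin 6}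
    (h : ∀ c, c ≠ c₀ → p c = p' c) : p = p' := by
  funext c
  by_cases hc : c = c₀
  · subst hc
    rw [← Finset.add_sum_erase _ _ (Finset.mem_univ c)] at hp hp'
    rw [Finset.sum_congr rfl fun c' hc' => h c' (Finset.ne_of_mem_erase hc')] at hp
    linarith
  · exact h c hc

/-- The five non-special colors continue through the corner, and the gauge constraint determines the
special one. -/
theorem lineMomentum_eq_of_lineStep (hq : q ∈ G.gaugeInvariant pext) {ℓ ℓ' : L}
    (h : G.LineStep ℓ ℓ') : G.lineMomentum pext q ℓ = G.lineMomentum pext q ℓ' :=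
  eq_of_sum_eq_zero (hq ℓ) (hq ℓ') (c₀ := G.color (G.tgt ℓ).1) fun _ hc =>
    lineMomentum_eq_of_faceStep ((G.faceStep_of_ne hc).2 h)

theorem lineMomentum_eq_of_node_eq (hq : q ∈ G.gaugeInvariant pext) {ℓ ℓ' : L}
    (h : G.node ℓ = G.node ℓ') : G.lineMomentum pext q ℓ = G.lineMomentum pext q ℓ' :=
  congrArg (Quot.lift (G.lineMomentum pext q) fun _ _ h => lineMomentum_eq_of_lineStep hq h) h

/-- The momentum of the lines of an open node is determined by the external momenta. -/
theorem lineMomentum_eq_of_not_isClosedNode (hq : q ∈ G.gaugeInvariant pext)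
    (hq' : q' ∈ G.gaugeInvariant pext) {ℓ : L} (h : ¬ G.IsClosedNode (G.node ℓ)) :
    G.lineMomentum pext q ℓ = G.lineMomentum pext q' ℓ := by
  simp only [IsClosedNode, not_forall, not_and_or] at h
  obtain ⟨ℓ₀, hℓ₀, h⟩ := h
  rw [lineMomentum_eq_of_node_eq hq hℓ₀.symm, lineMomentum_eq_of_node_eq hq' hℓ₀.symm]
  rcases h with h | h
  -- At an open end the five non-special faces are external, hence prescribed.
  · refine eq_of_sum_eq_zero (hq ℓ₀) (hq' ℓ₀) (c₀ := G.color (G.tgt ℓ₀).1) fun c hc =>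
      lineMomentum_eq_of_not_isInternal fun hint => h ?_
    obtain ⟨⟨ℓ', c'⟩, h'⟩ := (hint ℓ₀ c rfl).1
    obtain rfl : c = c' := h'.1
    exact ⟨ℓ', (G.faceStep_of_ne hc).1 h'⟩
  · refine eq_of_sum_eq_zero (hq ℓ₀) (hq' ℓ₀) (c₀ := G.color (G.src ℓ₀).1) fun c hc =>
      lineMomentum_eq_of_not_isInternal fun hint => h ?_
    obtain ⟨⟨ℓ', c'⟩, h'⟩ := (hint ℓ₀ c rfl).2
    obtain rfl : c' = c := h'.1
    refine ⟨ℓ', (G.faceStep_of_ne ?_).1 h'⟩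
    have : (G.strand c' (G.tgt ℓ')).1 = (G.src ℓ₀).1 := congrArg Prod.fst h'.2
    rwa [← this] at hc

/-- Two gauge invariant families of internal momenta coincide if they give the same momenta to the
closed nodes. -/
theorem eq_of_lineMomentum_eq (hq : q ∈ G.gaugeInvariant pext) (hq' : q' ∈ G.gaugeInvariant pext)
    (h : ∀ ℓ, G.IsClosedNode (G.node ℓ) → G.lineMomentum pext q ℓ = G.lineMomentum pext q' ℓ) :
    q = q' := by
  funext ⟨f, hf⟩
  have key : ∀ ℓ, G.lineMomentum pext q ℓ = G.lineMomentum pext q' ℓ := fun ℓ => by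
    by_cases hc : G.IsClosedNode (G.node ℓ)
    · exact h ℓ hc
    · exact lineMomentum_eq_of_not_isClosedNode hq hq' hc
  have h1 := congrFun (key (G.faceStrand f).1) (G.faceStrand f).2
  rw [lineMomentum, lineMomentum, G.face_faceStrand] at h1
  simpa [faceMomentum, hf] using h1

theorem mem_gaugeInvariant_of_integrand_ne_zero [Fintype L] {m : ℝ}
    (h : G.integrand m pext q ≠ 0) : q ∈ G.gaugeInvariant pext := fun ℓ =>
  sum_eq_zero_of_propagator_ne_zero (Finset.prod_ne_zero_iff.1 h ℓ (Finset.mem_univ ℓ))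

end Momenta

/-! ### Reduction of the integrand to the closed nodes -/

/-- A line of a node. -/
noncomputable def nodeLine (C : G.Node) : L := (G.node_surjective C).choose

theorem node_nodeLine (C : G.Node) : G.node (G.nodeLine C) = C := (G.node_surjective C).choose_spec

/-- The closed nodes with two lines. -/
def TwoNode [Fintype L] : Type _ := {C : G.Node // G.IsClosedNode C ∧ (G.nodeLines C).card = 2}

/-- The closed nodes that do not have two lines. -/
def LargeNode [Fintype L] : Type _ := {C : G.Node // G.IsClosedNode C ∧ (G.nodeLines C).card ≠ 2}

noncomputable instance [Fintype L] : Fintype G.TwoNode :=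
  Fintype.ofInjective (fun C => (C.1 : G.Node)) Subtype.val_injective

noncomputable instance [Fintype L] : Fintype G.LargeNode :=
  Fintype.ofInjective (fun C => (C.1 : G.Node)) Subtype.val_injective

theorem card_node_le [Fintype L] : Fintype.card G.Node ≤ Fintype.card L :=
  Fintype.card_le_of_surjective _ G.node_surjective

theorem card_twoNode_le [Fintype L] : Fintype.card G.TwoNode ≤ Fintype.card L :=
  (Fintype.card_le_of_injective (fun C : G.TwoNode => (C.1 : G.Node))
    Subtype.val_injective).trans G.card_node_le

theorem card_largeNode_le [Fintype L] : Fintype.card G.LargeNode ≤ Fintype.card L :=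
  (Fintype.card_le_of_injective (fun C : G.LargeNode => (C.1 : G.Node))
    Subtype.val_injective).trans G.card_node_le

theorem card_line_le (G : FeynmanGraph V L) [Fintype V] [Fintype L] :
    Fintype.card L ≤ 2 * Fintype.card V := by
  have := Fintype.card_le_of_injective _ G.src_injective
  rwa [Fintype.card_prod, Fintype.card_bool, mul_comm] at this

theorem prod_ite_one_eq_prod_subtype {ι M : Type*} [Fintype ι] [CommMonoid M] (p : ι → Prop)
    [DecidablePred p] {_ : Fintype {i // p i}} (F : ι → M) :
    ∏ i, (if p i then F i else 1) = ∏ i : {i // p i}, F i := by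
  rw [← Finset.prod_filter]
  exact Finset.prod_subtype _ (by simp) _

variable {G} in
open Classical in
/-- The integrand is bounded by the product of powers of the propagators of the closed nodes. -/
theorem IsCompletelyConvergent.integrand_le [Fintype L] (hG : G.IsCompletelyConvergent) {m : ℝ}
    (hm : 0 < m) (pext : {f // ¬ G.IsInternal f} → ℤ) {q : {f // G.IsInternal f} → ℤ}
    (hq : q ∈ G.gaugeInvariant pext) :
    ENNReal.ofReal (G.integrand m pext q) ≤ ENNReal.ofReal (max 1 (1 / m ^ 2)) ^ Fintype.card L *
      ((∏ C : G.LargeNode, ENNReal.ofReal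
          (propagator m (G.lineMomentum pext q (G.nodeLine C.1))) ^ 3) *
        ∏ C : G.TwoNode, ENNReal.ofReal
          (propagator m (G.lineMomentum pext q (G.nodeLine C.1))) ^ 2) := by
  set B := ENNReal.ofReal (max 1 (1 / m ^ 2)) with hB
  set x : G.Node → ℝ≥0∞ := fun C =>
    ENNReal.ofReal (propagator m (G.lineMomentum pext q (G.nodeLine C))) with hx
  have hxB : ∀ C, x C ≤ B := fun C =>
    ENNReal.ofReal_le_ofReal ((propagator_le hm _).trans (le_max_right _ _))
  have hB1 : 1 ≤ B := by
    rw [hB, ← ENNReal.ofReal_one]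
    exact ENNReal.ofReal_le_ofReal (le_max_left _ _)
  have hsum : Fintype.card L = ∑ C, (G.nodeLines C).card := by
    rw [← Finset.card_univ]
    exact Finset.card_eq_sum_card_fiberwise (f := G.node) (t := Finset.univ) (by simp)
  -- Only `k` propagators per node are kept, with `k` equal to 3, 2 or 0 for large, two-line and
  -- open nodes. The others are bounded by `B`.
  have hpow : ∀ C k, k ≤ (G.nodeLines C).card →
      x C ^ (G.nodeLines C).card ≤ B ^ (G.nodeLines C).card * x C ^ k := by
    intro C k hk
    calc x C ^ (G.nodeLines C).card = x C ^ ((G.nodeLines C).card - k) * x C ^ k := by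
          rw [← pow_add, Nat.sub_add_cancel hk]
      _ ≤ B ^ ((G.nodeLines C).card - k) * x C ^ k := by gcongr; exact hxB C
      _ ≤ _ := mul_le_mul' (pow_le_pow_right₀ hB1 (Nat.sub_le _ _)) le_rfl
  calc ENNReal.ofReal (G.integrand m pext q)
      = ∏ ℓ, ENNReal.ofReal (propagator m (G.lineMomentum pext q ℓ)) := by
        rw [integrand, ENNReal.ofReal_prod_of_nonneg fun _ _ => propagator_nonneg _ _]
        rfl
    _ = ∏ C, ∏ ℓ ∈ G.nodeLines C, ENNReal.ofReal (propagator m (G.lineMomentum pext q ℓ)) :=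
        (Finset.prod_fiberwise _ _ _).symm
    _ = ∏ C, x C ^ (G.nodeLines C).card := by
        refine Finset.prod_congr rfl fun C _ => ?_
        rw [Finset.prod_congr rfl fun ℓ hℓ => ?_, Finset.prod_const]
        rw [G.mem_nodeLines] at hℓ
        simp only [hx]
        rw [lineMomentum_eq_of_node_eq hq (hℓ.trans (G.node_nodeLine C).symm)]
    _ ≤ ∏ C, B ^ (G.nodeLines C).card *
        ((if G.IsClosedNode C ∧ (G.nodeLines C).card ≠ 2 then x C ^ 3 else 1) *
          if G.IsClosedNode C ∧ (G.nodeLines C).card = 2 then x C ^ 2 else 1) := by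
        refine Finset.prod_le_prod' fun C _ => ?_
        by_cases hC : G.IsClosedNode C
        · have h2 := hG.two_le_card_nodeLines hC
          by_cases hcard : (G.nodeLines C).card = 2
          · simpa [hC, hcard] using hpow C 2 hcard.ge
          · simpa [hC, hcard] using hpow C 3 (by omega)
        · simpa [hC] using hpow C 0 (Nat.zero_le _)
    _ = _ := by
        rw [Finset.prod_mul_distrib, Finset.prod_mul_distrib, Finset.prod_pow_eq_pow_sum, ← hsum]
        exact congrArg _ (congrArg₂ _ (prod_ite_one_eq_prod_subtype _ fun C => x C ^ 3)
          (prod_ite_one_eq_prod_subtype _ fun C => x C ^ 2))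

/-! ### Summation over the node momenta -/

section Sum

variable [Fintype L] (pext : {f // ¬ G.IsInternal f} → ℤ)

/-- The momenta of the closed nodes. -/
noncomputable def nodeMomenta (q : {f // G.IsInternal f} → ℤ) :
    (G.LargeNode → Fin 6 → ℤ) × (G.TwoNode → Fin 6 → ℤ) :=
  (fun C => G.lineMomentum pext q (G.nodeLine C.1), fun C => G.lineMomentum pext q (G.nodeLine C.1))

variable {G pext}

theorem lineMomentum_eq_of_nodeMomenta_fst_eq {q q' : {f // G.IsInternal f} → ℤ}
    (hq : q ∈ G.gaugeInvariant pext) (hq' : q' ∈ G.gaugeInvariant pext)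
    (h : (G.nodeMomenta pext q).1 = (G.nodeMomenta pext q').1) {ℓ : L}
    (hℓ : ¬ (G.IsClosedNode (G.node ℓ) ∧ (G.nodeLines (G.node ℓ)).card = 2)) :
    G.lineMomentum pext q ℓ = G.lineMomentum pext q' ℓ := by
  by_cases hc : G.IsClosedNode (G.node ℓ)
  · have h1 : G.lineMomentum pext q (G.nodeLine (G.node ℓ))
        = G.lineMomentum pext q' (G.nodeLine (G.node ℓ)) :=
      congrFun h ⟨G.node ℓ, hc, fun h => hℓ ⟨hc, h⟩⟩
    rwa [lineMomentum_eq_of_node_eq hq (G.node_nodeLine (G.node ℓ)),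
      lineMomentum_eq_of_node_eq hq' (G.node_nodeLine (G.node ℓ))] at h1
  · exact lineMomentum_eq_of_not_isClosedNode hq hq' hc

theorem nodeMomenta_injOn : Set.InjOn (G.nodeMomenta pext) (G.gaugeInvariant pext) := by
  intro q hq q' hq' h
  refine eq_of_lineMomentum_eq hq hq' fun ℓ hc => ?_
  by_cases h2 : (G.nodeLines (G.node ℓ)).card = 2
  · have h1 : G.lineMomentum pext q (G.nodeLine (G.node ℓ))
        = G.lineMomentum pext q' (G.nodeLine (G.node ℓ)) :=
      congrFun (congrArg Prod.snd h) ⟨G.node ℓ, hc, h2⟩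
    rwa [lineMomentum_eq_of_node_eq hq (G.node_nodeLine (G.node ℓ)),
      lineMomentum_eq_of_node_eq hq' (G.node_nodeLine (G.node ℓ))] at h1
  · exact lineMomentum_eq_of_nodeMomenta_fst_eq hq hq' (congrArg Prod.fst h) fun h => h2 h.2

open Classical in
/-- The sum over the momenta of the closed nodes with two lines, at fixed momenta of the other
nodes. -/
theorem IsCompletelyConvergent.tsum_twoNode_le (hG : G.IsCompletelyConvergent) {m : ℝ}
    (hm : 0 < m) (P₃ : G.LargeNode → Fin 6 → ℤ) :
    ∑' P : G.TwoNode → Fin 6 → ℤ,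
      (if (P₃, P) ∈ G.nodeMomenta pext '' G.gaugeInvariant pext then
        ∏ C, ENNReal.ofReal (propagator m (P C)) ^ 2 else 0)
      ≤ ENNReal.ofReal (schurConst m) ^ Fintype.card G.TwoNode := by
  -- If no configuration has these large-node momenta, all terms vanish. Otherwise `q₀` serves as a
  -- reference for the values at the ends of the chains.
  by_cases hex : ∃ q₀ ∈ G.gaugeInvariant pext, (G.nodeMomenta pext q₀).1 = P₃
  swap
  · refine le_of_eq_of_le (ENNReal.tsum_eq_zero.2 fun P => if_neg ?_) zero_le
    rintro ⟨q, hq, h⟩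
    exact hex ⟨q, hq, congrArg Prod.fst h⟩
  obtain ⟨q₀, hq₀, rfl⟩ := hex
  choose lam hinj hmem hstep hcol using fun C : G.TwoNode => hG.exists_two_cycle C.2.1 C.2.2
  set lam' : G.TwoNode × Bool → L := fun κ => lam κ.1 κ.2 with hlam'
  have hnode : ∀ κ, G.node (lam' κ) = κ.1.1 := fun κ => (hmem κ.1 _).2 ⟨κ.2, rfl⟩
  have hlam'_inj : Function.Injective lam' := by
    rintro ⟨C, b⟩ ⟨C', b'⟩ h
    obtain rfl : C = C' := Subtype.ext (by rw [← hnode (C, b), h, hnode])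
    exact Prod.ext rfl (hinj C h)
  set e : G.TwoNode × Bool → V × Bool := fun κ => G.tgt (lam' κ) with he
  have he_inj : Function.Injective e := G.tgt_injective.comp hlam'_inj
  set val : G.TwoNode × Bool → (Fin 6 → ℤ) → ℤ := fun κ p => p (G.color (e κ).1) with hval
  -- Delta functions, of `ℓ²` norm one: at a free corner the special-color face is external or
  -- enters a line outside the two-line nodes, so its momentum is that of `q₀`.
  set f : G.TwoNode × Bool → ℤ → ℝ≥0∞ := fun κ y =>
    if y = G.lineMomentum pext q₀ (lam' κ) (G.color (e κ).1) then 1 else 0 with hf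
  have hbound := chain_bound (K := ENNReal.ofReal (schurConst m) ^ 2)
    (w := fun p : Fin 6 → ℤ => ENNReal.ofReal (propagator m p) ^ 2)
    opposite_involutive opposite_ne (Fintype.card G.TwoNode) G.TwoNode e val f rfl he_inj
    (fun C b u v => ENNReal.schur_bilinear (g := schurWeight m) (schurWeight_ne_zero hm)
      (fun _ => ENNReal.ofReal_ne_top) (tsum_propagator_sq_schur hm (hcol C b))
      (tsum_propagator_sq_schur hm (hcol C b).symm) u v)
    (fun C b u => ENNReal.schur_operator (g := schurWeight m) (schurWeight_ne_zero hm)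
      (fun _ => ENNReal.ofReal_ne_top) (tsum_propagator_sq_schur hm (hcol C b))
      (tsum_propagator_sq_schur hm (hcol C b).symm) u)
    (fun J hJ => hG.exists_boundary hlam'_inj hstep hJ)
  have hnorm : ∏ κ, chainNorm opposite e f κ ≤ 1 := by
    refine Finset.prod_le_one' fun κ _ => ?_
    unfold chainNorm
    split_ifs
    · exact le_rfl
    · simp [hf]
  have hle : ∀ P : G.TwoNode → Fin 6 → ℤ,
      (if ((G.nodeMomenta pext q₀).1, P) ∈ G.nodeMomenta pext '' G.gaugeInvariant pext then
        ∏ C, ENNReal.ofReal (propagator m (P C)) ^ 2 else 0)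
      ≤ (∏ C, ENNReal.ofReal (propagator m (P C)) ^ 2) * ∏ κ, chainFactor opposite e val f P κ := by
    intro P
    split_ifs with hP
    swap
    · exact zero_le
    obtain ⟨q, hq, hqP⟩ := hP
    have h3 : (G.nodeMomenta pext q).1 = (G.nodeMomenta pext q₀).1 := by rw [hqP]
    have h2 : ∀ κ, P κ.1 = G.lineMomentum pext q (lam' κ) := fun κ => by
      rw [← show (G.nodeMomenta pext q).2 = P from congrArg Prod.snd hqP]
      exact lineMomentum_eq_of_node_eq hq ((G.node_nodeLine κ.1.1).trans (hnode κ).symm)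
    refine le_of_eq_of_le (mul_one _).symm (mul_le_mul' le_rfl (Finset.prod_eq_one fun κ _ => ?_).ge)
    unfold chainFactor
    split_ifs with h1 h4
    · rfl
    · refine absurd (fun κ' hκ' => ?_) h4
      simp only [hval]
      rw [h2 κ, hκ', h2 (κ'.1, !κ'.2)]
      -- The special-color face leaving corner `κ` enters the line that follows corner `κ'`, which
      -- belongs to the same node as `lam' κ'`.
      refine lineMomentum_eq_of_faceStep ((G.faceStep_of_eq rfl).2 ?_)
      exact hκ'.symm.trans (hstep κ'.1 κ'.2)
    · simp only [hf, hval]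
      rw [if_pos]
      rw [h2 κ]
      by_cases hℓ : ∃ ℓ', opposite (e κ) = G.src ℓ'
      · obtain ⟨ℓ', hℓ'⟩ := hℓ
        have hfs := (G.faceStep_of_eq (ℓ := lam' κ) (ℓ' := ℓ') rfl).2 hℓ'
        rw [lineMomentum_eq_of_faceStep hfs, lineMomentum_eq_of_faceStep hfs,
          lineMomentum_eq_of_nodeMomenta_fst_eq hq hq₀ h3]
        -- If `ℓ'` were in a two-line node, its predecessor there would provide a corner glued to
        -- `κ`.
        intro hC
        obtain ⟨b, hb⟩ := (hmem ⟨_, hC⟩ ℓ').1 rfl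
        refine h1 ⟨(⟨_, hC⟩, !b), ?_⟩
        have := hstep ⟨_, hC⟩ (!b)
        rw [Bool.not_not, hb] at this
        exact Eq.trans this hℓ'.symm
      · refine lineMomentum_eq_of_not_isInternal fun hint => hℓ ?_
        obtain ⟨⟨ℓ', c'⟩, h'⟩ := (hint (lam' κ) _ rfl).1
        obtain rfl := h'.1
        exact ⟨ℓ', (G.faceStep_of_eq rfl).1 h'⟩
  refine (ENNReal.tsum_le_tsum hle).trans ?_
  refine (ENNReal.pow_le_pow_left_iff two_ne_zero).1 (hbound.trans ?_)
  rw [← pow_mul, mul_comm 2, pow_mul]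
  exact (mul_le_mul' le_rfl hnorm).trans_eq (mul_one _)

open Classical in
/-- The uniform bound on the sum of the integrand. -/
theorem IsCompletelyConvergent.tsum_integrand_le (hG : G.IsCompletelyConvergent) {m : ℝ}
    (hm : 0 < m) :
    ∑' q, ENNReal.ofReal (G.integrand m pext q)
      ≤ ENNReal.ofReal (max 1 (1 / m ^ 2)) ^ Fintype.card L *
        (ENNReal.ofReal ((1 / m + 4) ^ 5 * m⁻¹) ^ Fintype.card G.LargeNode *
          ENNReal.ofReal (schurConst m) ^ Fintype.card G.TwoNode) := by
  have hsupp : Function.support (fun q => ENNReal.ofReal (G.integrand m pext q))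
      ⊆ G.gaugeInvariant pext := by
    intro q hq
    refine mem_gaugeInvariant_of_integrand_ne_zero (m := m) fun h => hq ?_
    simp [h]
  rw [← tsum_subtype_eq_of_support_subset hsupp]
  refine (ENNReal.tsum_le_tsum fun q => hG.integrand_le hm pext q.2).trans ?_
  rw [ENNReal.tsum_mul_left]
  gcongr
  -- The compatibility constraint is kept for the sum over two-line nodes. Once that sum is bounded
  -- uniformly in the large-node momenta, these become independent.
  set F : (G.LargeNode → Fin 6 → ℤ) × (G.TwoNode → Fin 6 → ℤ) → ℝ≥0∞ := fun z =>
    (∏ C, ENNReal.ofReal (propagator m (z.1 C)) ^ 3) *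
      if z ∈ G.nodeMomenta pext '' G.gaugeInvariant pext then
        ∏ C, ENNReal.ofReal (propagator m (z.2 C)) ^ 2 else 0 with hF
  calc _ = ∑' q : G.gaugeInvariant pext, F (G.nodeMomenta pext q) := by
        refine tsum_congr fun q => ?_
        rw [hF]
        simp only
        rw [if_pos (Set.mem_image_of_mem _ q.2)]
        rfl
    _ ≤ ∑' z, F z := ENNReal.tsum_comp_le_tsum_of_injective
        (f := fun q : G.gaugeInvariant pext => G.nodeMomenta pext q)
        (fun q q' h => Subtype.ext (nodeMomenta_injOn q.2 q'.2 h)) F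
    _ ≤ ∑' P₃ : G.LargeNode → Fin 6 → ℤ, (∏ C, ENNReal.ofReal (propagator m (P₃ C)) ^ 3) *
          ENNReal.ofReal (schurConst m) ^ Fintype.card G.TwoNode := by
        rw [ENNReal.tsum_prod']
        refine ENNReal.tsum_le_tsum fun P₃ => ?_
        simp only [hF]
        rw [ENNReal.tsum_mul_left]
        gcongr
        exact hG.tsum_twoNode_le hm P₃
    _ ≤ _ := by
        rw [ENNReal.tsum_mul_right, tsum_pi_prod (fun p => ENNReal.ofReal (propagator m p) ^ 3)
          (Fintype.card G.LargeNode) G.LargeNode rfl]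
        gcongr
        exact tsum_propagator_cube_le hm

end Sum

end FeynmanGraph

/-! ### The uniform bound -/

theorem mainTheorem6 (m : ℝ) (hm : 0 < m) :
    ∃ K : ℝ, 0 < K ∧
      ∀ (V : Type*) (L : Type*) [Fintype V] [Fintype L] (G : FeynmanGraph V L),
        G.IsConnected → G.IsCompletelyConvergent →
          ∀ pext : {f : G.Face // ¬ G.IsInternal f} → ℤ,
            Summable (G.integrand m pext) ∧
              |G.amplitude m pext| ≤ K ^ Fintype.card V := by
  set a := max 1 (1 / m ^ 2) with ha
  set b := (1 / m + 4) ^ 5 * m⁻¹ with hb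
  set c := FeynmanGraph.schurConst m with hc
  set k := max a (max b c) with hk
  have hk1 : 1 ≤ k := (le_max_left _ _).trans (le_max_left _ _)
  -- The exponent 3 counts the three factors of the bound, each at most `k` per line, and 2 is the
  -- maximal number of lines per vertex.
  refine ⟨(k ^ 3) ^ 2, by positivity, fun V L _ _ G _ hG pext => ?_⟩
  have hbound : ∑' q, ENNReal.ofReal (G.integrand m pext q)
      ≤ ENNReal.ofReal (((k ^ 3) ^ 2) ^ Fintype.card V) := by
    have h1 : (1 : ENNReal) ≤ ENNReal.ofReal k := by
      rw [← ENNReal.ofReal_one]; exact ENNReal.ofReal_le_ofReal hk1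
    calc _ ≤ _ := hG.tsum_integrand_le hm
      _ ≤ ENNReal.ofReal k ^ Fintype.card L *
          (ENNReal.ofReal k ^ Fintype.card L * ENNReal.ofReal k ^ Fintype.card L) := by
        refine mul_le_mul' ?_ (mul_le_mul' ?_ ?_)
        · exact pow_le_pow_left' (ENNReal.ofReal_le_ofReal (le_max_left _ _)) _
        · exact (pow_le_pow_left' (ENNReal.ofReal_le_ofReal
            ((le_max_left _ _).trans (le_max_right _ _))) _).trans
            (pow_le_pow_right₀ h1 G.card_largeNode_le)
        · exact (pow_le_pow_left' (ENNReal.ofReal_le_ofReal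
            ((le_max_right _ _).trans (le_max_right _ _))) _).trans
            (pow_le_pow_right₀ h1 G.card_twoNode_le)
      _ = (ENNReal.ofReal k ^ 3) ^ Fintype.card L := by ring
      _ ≤ (ENNReal.ofReal k ^ 3) ^ (2 * Fintype.card V) :=
        pow_le_pow_right₀ (one_le_pow₀ h1) G.card_line_le
      _ = _ := by
        rw [pow_mul, ENNReal.ofReal_pow (by positivity), ENNReal.ofReal_pow (by positivity),
          ENNReal.ofReal_pow (by positivity)]
  have hnonneg : ∀ q, 0 ≤ G.integrand m pext q := fun q =>
    Finset.prod_nonneg fun _ _ => FeynmanGraph.propagator_nonneg _ _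
  have hsum : Summable (G.integrand m pext) := by
    have h := ENNReal.summable_toReal (ne_top_of_le_ne_top ENNReal.ofReal_ne_top hbound)
    simpa only [ENNReal.toReal_ofReal (hnonneg _)] using h
  refine ⟨hsum, ?_⟩
  rw [FeynmanGraph.amplitude, abs_of_nonneg (tsum_nonneg hnonneg),
    ← ENNReal.ofReal_le_ofReal_iff (by positivity), ENNReal.ofReal_tsum_of_nonneg hnonneg hsum]
  exact hbound
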